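/- **Setting.** Let $G=(V,E)$ be a finite connected simple graph and let two agents $i\in\{1,2\}$ have additive utilities $u_i(X)=\sum_{v\in X}u_i(v)$ with $u_i(v)\ge 0$ for $v\in V$. A bundle $X\subseteq V$ is *connected* if it is empty or induces a connected subgraph of $G$. A *connected allocation* $A=(A_1,A_2)$ is a partition of $V$ into two (possibly empty) connected bundles. For a bundle $X$ and $k\ge 1$ let $$\mu_i^k(X)=\max\{\min_{j\le k}u_i(B_j) : (B_1,\dots,B_k)\text{ a partition of }X\text{ into }k\text{ (possibly empty) connected bundles}\}.$$ For $\alpha>0$, the allocation $A$ is *$\alpha$-PMMS* if $u_i(A_i)\ge\alpha\,\mu_i^2(A_i\cup A_j)$ for all agents $i\ne j$ such that $A_i=\emptyset$ or some edge of $G$ joins $A_i$ to $A_j$. It is *$\alpha$-MMS* if $u_i(A_i)\ge\alpha\,\mu_i^2(V)$ for both agents $i$ (here the number of agents is $2$). **Theorem.** (a) For two agents with additive non-negative real utilities, a connected allocation of a connected graph is $(3/4)$-PMMS if and only if it is $(3/4)$-MMS. (b) A $(3/4)$-PMMS (equivalently, $(3/4)$-MMS) connected allocation can be computed in polynomial time.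 Precisely, there are one program for a random access machine, whose only arithmetic is addition and subtraction and whose only tests are comparisons, and one polynomial $p$ such that, for every connected graph $G$ on $n$ vertices (given by its adjacency matrix) and every pair of additive non-negative utilities (given by the numbers $u_i(v)$), the program halts with a connected allocation that is $(3/4)$-PMMS and $(3/4)$-MMS, and * for real utilities, its running time is at most $p(n)$ when operations on utility values have unit cost (and natural numbers have logarithmic cost); * for rational utilities, its running time in the logarithmic-cost (bit-length) measure is at most $p(n+L)$, where $L$ is the total bit length of all the numbers $u_i(v)$. -/

import Mathlib

namespace GraphFairDivision

/-! ## Fair division of the vertices of a graph -/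

section Fairness

variable {V : Type*} [Fintype V] [DecidableEq V]

/-- Additive utility of a bundle, given the utilities `w v` of the single items. -/
def util (w : V → ℝ) (X : Finset V) : ℝ := ∑ v ∈ X, w v

/-- The bundle `X` induces a connected subgraph of `G`; the empty bundle counts as connected. -/
def IsConnectedBundle (G : SimpleGraph V) (X : Finset V) : Prop :=
  (G.induce (X : Set V)).Preconnected

/-- `A 0, …, A (k-1)` is a partition of `X` into `k` connected (possibly empty) bundles. -/
def IsConnectedPartition (G : SimpleGraph V) {k : ℕ} (X : Finset V) (A : Fin k → Finset V) :
    Prop :=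
  (∀ i, IsConnectedBundle G (A i)) ∧ (∀ i j, i ≠ j → Disjoint (A i) (A j)) ∧
    Finset.univ.biUnion A = X

/-- A connected allocation of all vertices to `k` agents. -/
def IsConnectedAllocation (G : SimpleGraph V) {k : ℕ} (A : Fin k → Finset V) : Prop :=
  IsConnectedPartition G Finset.univ A

/-- The `k`-maximin share of a bundle `X`: the maximum, over all partitions of `X` into `k`
connected bundles, of the minimum utility of a part (the maximum of a finite set of reals). -/
noncomputable def maximinShare (G : SimpleGraph V) (w : V → ℝ) (k : ℕ) (X : Finset V) : ℝ :=
  sSup {x : ℝ | ∃ A : Fin k → Finset V, IsConnectedPartition G X A ∧ x = ⨅ j, util w (A j)}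

/-- Agents `i` and `j` are adjacent under `A`: some edge joins their bundles. -/
def AdjacentUnder (G : SimpleGraph V) {k : ℕ} (A : Fin k → Finset V) (i j : Fin k) : Prop :=
  ∃ x ∈ A i, ∃ y ∈ A j, G.Adj x y

/-- `α`-approximate pairwise maximin share fairness. -/
def IsApproxPMMS (G : SimpleGraph V) {k : ℕ} (u : Fin k → V → ℝ) (α : ℝ)
    (A : Fin k → Finset V) : Prop :=
  ∀ i j, i ≠ j → (A i = ∅ ∨ AdjacentUnder G A i j) →
    α * maximinShare G (u i) 2 (A i ∪ A j) ≤ util (u i) (A i)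

/-- `α`-approximate maximin share fairness. -/
def IsApproxMMS (G : SimpleGraph V) {k : ℕ} (u : Fin k → V → ℝ) (α : ℝ)
    (A : Fin k → Finset V) : Prop :=
  ∀ i, α * maximinShare G (u i) k Finset.univ ≤ util (u i) (A i)

end Fairness

/-! ## Programs with a step count

A random access machine, written as a structured program.  The memory consists of
arrays of natural numbers and arrays of *values* (numbers from `R`, here `ℝ` or `ℚ`); a cell is
addressed by a constant array number and two computed natural-number indices.  The only arithmetic
is addition and subtraction (truncated on `ℕ`), and the only tests are comparisons.

The cost is parametrised by a size `sz : R → ℕ` of values.  Every elementary operation costs `1`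
plus the bit length of the natural number, or the size of the value, that it produces.  With the bit
length of rationals as `sz` this is the logarithmic-cost measure; with `sz = 0` an
operation on values costs one unit (the usual convention for exact real numbers). -/

/-- A memory state: `ints a i j` and `vals a i j` are the cells `(i, j)` of the `a`-th arrays. -/
structure State (R : Type) where
  ints : ℕ → ℕ → ℕ → ℕ
  vals : ℕ → ℕ → ℕ → R

/-- Expressions denoting natural numbers. -/
inductive IExp where
  | const (c : ℕ)
  | get (a : ℕ) (i j : IExp)
  | add (x y : IExp)
  | sub (x y : IExp)

/-- Expressions denoting values. -/
inductive VExp where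
  | zero
  | get (a : ℕ) (i j : IExp)
  | add (x y : VExp)
  | sub (x y : VExp)

/-- Tests. -/
inductive BExp where
  | intLE (x y : IExp)
  | valLE (x y : VExp)
  | neg (b : BExp)
  | conj (b c : BExp)

/-- Programs. -/
inductive Prog where
  | skip
  | setInt (a : ℕ) (i j e : IExp)
  | setVal (a : ℕ) (i j : IExp) (e : VExp)
  | seq (P Q : Prog)
  | ite (b : BExp) (P Q : Prog)
  | loop (b : BExp) (P : Prog)

section Semantics

variable {R : Type}

/-- Write `x` into cell `(i, j)` of the integer array `a`. -/
def State.setInt (s : State R) (a i j x : ℕ) : State R :=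
  { s with ints := fun a' i' j' => if a' = a ∧ i' = i ∧ j' = j then x else s.ints a' i' j' }

/-- Write `x` into cell `(i, j)` of the value array `a`. -/
def State.setVal (s : State R) (a i j : ℕ) (x : R) : State R :=
  { s with vals := fun a' i' j' => if a' = a ∧ i' = i ∧ j' = j then x else s.vals a' i' j' }

def IExp.eval (s : State R) : IExp → ℕ
  | .const c => c
  | .get a i j => s.ints a (i.eval s) (j.eval s)
  | .add x y => x.eval s + y.eval s
  | .sub x y => x.eval s - y.eval s

def IExp.cost (s : State R) : IExp → ℕ
  | .const c => 1 + Nat.size c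
  | .get a i j => i.cost s + j.cost s + 1 + Nat.size ((IExp.get a i j).eval s)
  | .add x y => x.cost s + y.cost s + 1 + Nat.size ((IExp.add x y).eval s)
  | .sub x y => x.cost s + y.cost s + 1 + Nat.size ((IExp.sub x y).eval s)

variable [AddCommGroup R] [LinearOrder R]

def VExp.eval (s : State R) : VExp → R
  | .zero => 0
  | .get a i j => s.vals a (i.eval s) (j.eval s)
  | .add x y => x.eval s + y.eval s
  | .sub x y => x.eval s - y.eval s

def VExp.cost (sz : R → ℕ) (s : State R) : VExp → ℕ
  | .zero => 1 + sz 0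
  | .get a i j => i.cost s + j.cost s + 1 + sz ((VExp.get a i j).eval s)
  | .add x y => x.cost sz s + y.cost sz s + 1 + sz ((VExp.add x y).eval s)
  | .sub x y => x.cost sz s + y.cost sz s + 1 + sz ((VExp.sub x y).eval s)

def BExp.holds (s : State R) : BExp → Prop
  | .intLE x y => x.eval s ≤ y.eval s
  | .valLE x y => x.eval s ≤ y.eval s
  | .neg b => ¬ b.holds s
  | .conj b c => b.holds s ∧ c.holds s

def BExp.cost (sz : R → ℕ) (s : State R) : BExp → ℕ
  | .intLE x y => x.cost s + y.cost s + 1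
  | .valLE x y => x.cost sz s + y.cost sz s + 1
  | .neg b => b.cost sz s + 1
  | .conj b c => b.cost sz s + c.cost sz s + 1

/-- `Exec sz P s t s'`: started in state `s`, the program `P` halts in state `s'`, and its
run costs exactly `t`. -/
inductive Exec (sz : R → ℕ) : Prog → State R → ℕ → State R → Prop
  | skip (s) : Exec sz .skip s 1 s
  | setInt (a i j e) (s : State R) :
      Exec sz (.setInt a i j e) s (i.cost s + j.cost s + e.cost s + 1)
        (s.setInt a (i.eval s) (j.eval s) (e.eval s))
  | setVal (a i j e) (s : State R) :
      Exec sz (.setVal a i j e) s (i.cost s + j.cost s + e.cost sz s + 1)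
        (s.setVal a (i.eval s) (j.eval s) (e.eval s))
  | seq {P Q s s' s'' t t'} (hP : Exec sz P s t s') (hQ : Exec sz Q s' t' s'') :
      Exec sz (.seq P Q) s (t + t') s''
  | ite_true {b P Q s s' t} (hb : b.holds s) (hP : Exec sz P s t s') :
      Exec sz (.ite b P Q) s (b.cost sz s + 1 + t) s'
  | ite_false {b P Q s s' t} (hb : ¬ b.holds s) (hQ : Exec sz Q s t s') :
      Exec sz (.ite b P Q) s (b.cost sz s + 1 + t) s'
  | loop_done {b P s} (hb : ¬ b.holds s) :
      Exec sz (.loop b P) s (b.cost sz s + 1) s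
  | loop_step {b P s s' s'' t t'} (hb : b.holds s) (hP : Exec sz P s t s')
      (hL : Exec sz (.loop b P) s' t' s'') :
      Exec sz (.loop b P) s (b.cost sz s + 1 + t + t') s''

end Semantics

/-! ## Input, output and input size -/

open Classical in
/-- The initial state for a graph on the vertices `0, …, n-1` and two agents: integer array `0`
holds `n` in cell `(0, 0)`, integer array `1` the adjacency matrix, value array `0` the utility
`u i v` in cell `(i, v)`; all other cells are zero. -/
noncomputable def inputState {R : Type} [Zero R] {n : ℕ} (G : SimpleGraph (Fin n))
    (u : Fin 2 → Fin n → R) : State R where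
  ints a i j :=
    if a = 0 ∧ i = 0 ∧ j = 0 then n
    else if a = 1 ∧ ∃ (hi : i < n) (hj : j < n), G.Adj ⟨i, hi⟩ ⟨j, hj⟩ then 1
    else 0
  vals a i j := if h : a = 0 ∧ i < 2 ∧ j < n then u ⟨i, h.2.1⟩ ⟨j, h.2.2⟩ else 0

/-- The bundles read off a final state: agent `a` gets the vertices `v` for which cell `(0, v)` of
the integer array `2` holds `a`. -/
def outputBundles {R : Type} (n : ℕ) (s : State R) : Fin 2 → Finset (Fin n) :=
  fun a => Finset.univ.filter fun v => s.ints 2 0 v = a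

/-- Bit length of a rational number. -/
def ratSize (q : ℚ) : ℕ := Nat.size q.num.natAbs + Nat.size q.den

/-- Size of an instance with rational utilities: the number of vertices plus the total bit length
of all utilities. -/
def inputSize {n : ℕ} (u : Fin 2 → Fin n → ℚ) : ℕ := n + ∑ i, ∑ v, ratSize (u i v)

end GraphFairDivision

open GraphFairDivision

set_option linter.unusedSectionVars false

/-! The allocation comes from cut and choose. A 2-maximin share of `V` is at most half of the total
utility (`two_mul_maximinShare_le`), so the agent who takes the part she prefers is satisfied. It
remains to cut: find a connected bipartition whose `balance`, for the first agent, is at least 3/4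
of the best possible.

The candidates are the bipartitions met by sweeps, one for each ordered pair `s ≠ t`. That they
suffice is `three_mul_balance_le`. Let W be the total utility, β at least every balance met, and
suppose a connected bipartition `X`, `Xᶜ` has balance m > 4β/3. The first bundles of the sweeps give
every vertex b a hanging set `H b` of utility at most β on b's side of `X`. Being lighter than W/2,
these sets are nested or disjoint (`IsHanging.subset_of_mem`), and the maximal ones partition `V`.
Let s and t be the bases of the two heaviest maximal sets. The sweep from s to t starts above W/2
and ends below it. The step that crosses W/2 loses at most `H v` for a third maximal base v
(`SweepStep.exists_sdiff_subset`), and both bundles around it have balance at most β, so W ≤ 2β +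
w(H v). Two of s, t, v lie on the same side of `X`, so the other side has at most W - 2 w(H v). Thus
m ≤ W - 2 w(H v) ≤ 4β - W ≤ 4β - 2m, a contradiction.

For the running time, all loops of the program run through the vertices, and the only values it
computes are sums of utilities over bundles, whose bit length is linear in the input
(`ratSize_sum_le`). A strictly monotone additive map `φ : R →+ ℝ` lets one proof serve real and
rational utilities.

For part (a), the two bundles together are `V`, so both notions use the same share. They could
differ only for an agent whose nonempty bundle has no edge to the other; connectedness then makes
that bundle all of `V`. -/

namespace GraphFairDivision

/-! ## Components of a bundle -/

section Components

variable {V : Type*} [Fintype V] [DecidableEq V] {G : SimpleGraph V}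

open Classical in
/-- The vertices that can be reached from `t` by a walk whose vertices after `t` lie in `A`. -/
noncomputable def reach (G : SimpleGraph V) (A : Finset V) (t : V) : Finset V :=
  Finset.univ.filter fun v => Relation.ReflTransGen (fun x y => G.Adj x y ∧ y ∈ A) t v

/-- Every two vertices of `X` are joined by a walk inside `X`. -/
def Linked (G : SimpleGraph V) (X : Finset V) : Prop :=
  ∀ x ∈ X, ∀ y ∈ X, y ∈ reach G X x

theorem mem_reach {A : Finset V} {t v : V} :
    v ∈ reach G A t ↔ Relation.ReflTransGen (fun x y => G.Adj x y ∧ y ∈ A) t v := by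
  simp [reach]

theorem self_mem_reach (A : Finset V) (t : V) : t ∈ reach G A t :=
  mem_reach.2 .refl

theorem reach_closed {A : Finset V} {t x y : V} (hx : x ∈ reach G A t) (h : G.Adj x y)
    (hy : y ∈ A) : y ∈ reach G A t :=
  mem_reach.2 ((mem_reach.1 hx).tail ⟨h, hy⟩)

/-- The induction principle for `reach`: most later facts about components exhibit a suitable closed
set. -/
theorem reach_subset_of_closed {A C : Finset V} {t : V} (ht : t ∈ C)
    (hC : ∀ x ∈ C, ∀ y ∈ A, G.Adj x y → y ∈ C) : reach G A t ⊆ C := by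
  intro v hv
  induction mem_reach.1 hv with
  | refl => exact ht
  | tail h1 h2 ih => exact hC _ (ih (mem_reach.2 h1)) _ h2.2 h2.1

theorem reach_subset {A : Finset V} {t : V} (ht : t ∈ A) : reach G A t ⊆ A :=
  reach_subset_of_closed ht fun _ _ _ hy _ => hy

theorem reach_trans {A : Finset V} {x y z : V} (hy : y ∈ reach G A x) (hz : z ∈ reach G A y) :
    z ∈ reach G A x :=
  mem_reach.2 ((mem_reach.1 hy).trans (mem_reach.1 hz))

theorem reach_mono {A B : Finset V} (h : A ⊆ B) (t : V) : reach G A t ⊆ reach G B t :=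
  reach_subset_of_closed (self_mem_reach _ _) fun _ hx _ hy hxy => reach_closed hx hxy (h hy)

theorem reach_symm {A : Finset V} {x y : V} (hx : x ∈ A) (hy : y ∈ reach G A x) :
    x ∈ reach G A y := by
  have : reach G A x ⊆ A.filter fun y => x ∈ reach G A y := by
    refine reach_subset_of_closed (by simp [hx, self_mem_reach]) ?_
    intro a ha b hb hab
    rw [Finset.mem_filter] at ha ⊢
    exact ⟨hb, reach_trans (reach_closed (self_mem_reach _ _) hab.symm ha.1) ha.2⟩
  exact (Finset.mem_filter.1 (this hy)).2

theorem reach_eq_of_mem {A : Finset V} {x y : V} (hx : x ∈ A) (hy : y ∈ reach G A x) :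
    reach G A y = reach G A x :=
  Finset.Subset.antisymm (fun _ hz => reach_trans hy hz)
    fun _ hz => reach_trans (reach_symm hx hy) hz

theorem Linked.subset_reach {A X : Finset V} {x t : V} (hX : Linked G X) (hA : X ⊆ A)
    (hx : x ∈ X) (ht : x ∈ reach G A t) : X ⊆ reach G A t :=
  fun y hy => reach_trans ht (reach_mono hA _ (hX x hx y hy))

theorem linked_of_center {X : Finset V} {c : V} (hc : c ∈ X) (h : X ⊆ reach G X c) :
    Linked G X :=
  fun _ hx _ hy => reach_trans (reach_symm hc (h hx)) (h hy)

theorem linked_reach (A : Finset V) (t : V) : Linked G (reach G A t) := by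
  refine linked_of_center (self_mem_reach A t) ?_
  have h : reach G A t ⊆ reach G A t ∩ reach G (reach G A t) t := by
    refine reach_subset_of_closed (by simp [self_mem_reach]) ?_
    intro x hx y hy hxy
    rw [Finset.mem_inter] at hx ⊢
    exact ⟨reach_closed hx.1 hxy hy, reach_closed hx.2 hxy (reach_closed hx.1 hxy hy)⟩
  exact fun x hx => (Finset.mem_inter.1 (h hx)).2

theorem Linked.union {X Y : Finset V} {x y : V} (hX : Linked G X) (hY : Linked G Y)
    (hx : x ∈ X) (hy : y ∈ Y) (h : G.Adj x y) : Linked G (X ∪ Y) := by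
  refine linked_of_center (Finset.mem_union_left Y hx) ?_
  have hxy : y ∈ reach G (X ∪ Y) x :=
    reach_closed (self_mem_reach _ _) h (Finset.mem_union_right X hy)
  exact Finset.union_subset
    (hX.subset_reach Finset.subset_union_left hx (self_mem_reach _ _))
    (hY.subset_reach Finset.subset_union_right hy hxy)

theorem linked_empty : Linked G (∅ : Finset V) := by simp [Linked]

/-- Removing from a connected bundle one component of the complement of a vertex leaves a connected
bundle. -/
theorem Linked.sdiff_reach {T : Finset V} {t v : V} (hT : Linked G T) (hv : v ∈ T) (ht : t ∈ T)
    (hvt : v ≠ t) : Linked G (T \ reach G (T.erase v) t) := by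
  have htv : t ∈ T.erase v := Finset.mem_erase.2 ⟨hvt.symm, ht⟩
  have hvn : v ∉ reach G (T.erase v) t := fun h => by simpa using reach_subset htv h
  have hvZ : v ∈ T \ reach G (T.erase v) t := Finset.mem_sdiff.2 ⟨hv, hvn⟩
  refine linked_of_center hvZ ?_
  -- A walk from `v` may wander through the removed component, but inside `T` it can leave that
  -- component only at `v`, where it starts afresh.
  have hC : reach G T v ⊆ reach G (T \ reach G (T.erase v) t) v ∪ reach G (T.erase v) t := by
    refine reach_subset_of_closed (by simp [self_mem_reach]) ?_
    intro x hx y hy hxy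
    by_cases hy' : y ∈ reach G (T.erase v) t
    · exact Finset.mem_union_right _ hy'
    refine Finset.mem_union_left _ ?_
    rcases Finset.mem_union.1 hx with hx | hx
    · exact reach_closed hx hxy (Finset.mem_sdiff.2 ⟨hy, hy'⟩)
    · by_cases hyv : y = v
      · rw [hyv]; exact self_mem_reach _ _
      · exact absurd (reach_closed hx hxy (Finset.mem_erase.2 ⟨hyv, hy⟩)) hy'
  intro x hx
  rw [Finset.mem_sdiff] at hx
  exact (Finset.mem_union.1 (hC (hT v hv x hx.1))).resolve_right hx.2

theorem isConnectedBundle_iff_linked {X : Finset V} : IsConnectedBundle G X ↔ Linked G X := by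
  constructor
  · intro h x hx y hy
    obtain ⟨p⟩ := h ⟨x, hx⟩ ⟨y, hy⟩
    suffices H : ∀ (a b : (X : Set V)), (G.induce (X : Set V)).Walk a b →
        (b : V) ∈ reach G X a from H _ _ p
    intro a b p
    induction p with
    | nil => exact self_mem_reach _ _
    | @cons a b c hab _ ih =>
      exact reach_trans (reach_closed (self_mem_reach _ _) hab (Finset.mem_coe.1 b.2)) ih
  · rintro h ⟨x, hx⟩ ⟨y, hy⟩
    have key : ∀ z ∈ reach G X x, ∃ hz : z ∈ (X : Set V),
        (G.induce (X : Set V)).Reachable ⟨x, hx⟩ ⟨z, hz⟩ := by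
      intro z hz
      induction mem_reach.1 hz with
      | refl => exact ⟨hx, .refl _⟩
      | @tail a b h1 h2 ih =>
        obtain ⟨ha, hr⟩ := ih (mem_reach.2 h1)
        exact ⟨h2.2, hr.trans (SimpleGraph.Adj.reachable (G := G.induce (X : Set V))
          (u := ⟨a, ha⟩) (v := ⟨b, h2.2⟩) h2.1)⟩
    exact (key y (h x hx y hy)).2

theorem linked_univ (hG : G.Connected) : Linked G Finset.univ := by
  intro x _ y _
  obtain ⟨p⟩ := hG.preconnected x y
  induction p with
  | nil => exact self_mem_reach _ _
  | cons hab _ ih =>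
    exact reach_trans (reach_closed (self_mem_reach _ _) hab (Finset.mem_univ _))
      (ih (Finset.mem_univ _) (Finset.mem_univ _))

end Components

/-! ## Sweeping the graph from one vertex to another -/

section Sweep

variable {V : Type*} [Fintype V] [DecidableEq V] {G : SimpleGraph V}

/-- The smaller utility of the two parts `T` and `Tᶜ`. -/
noncomputable def balance (w : V → ℝ) (T : Finset V) : ℝ := min (util w T) (util w Tᶜ)

/-- `v` is a vertex of `T` other than `t` with a neighbour outside `T`. -/
def IsBoundary (G : SimpleGraph V) (t : V) (T : Finset V) (v : V) : Prop :=
  v ∈ T ∧ v ≠ t ∧ ∃ x, x ∉ T ∧ G.Adj x v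

/-- `T'` arises from `T` by removing a boundary vertex with everything it separates from `t`, such
that no other boundary vertex is removed; `T' = T` if there is no boundary vertex. -/
def SweepStep (G : SimpleGraph V) (t : V) (T T' : Finset V) : Prop :=
  ((∀ v, ¬ IsBoundary G t T v) ∧ T' = T) ∨
    ∃ v, IsBoundary G t T v ∧ T' = reach G (T.erase v) t ∧
      ∀ y, IsBoundary G t T y → y = v ∨ y ∈ T'

/-- `T` is the `k`-th bundle of a sweep from `s` to `t`, and the partitions given by the earlier
bundles have balance at most `β`. -/
inductive Sweep (G : SimpleGraph V) (w : V → ℝ) (β : ℝ) (s t : V) : ℕ → Finset V → Prop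
  | zero : Sweep G w β s t 0 (reach G (Finset.univ.erase s) t)
  | succ {k T T'} (h : Sweep G w β s t k T) (hT : balance w T ≤ β) (hstep : SweepStep G t T T') :
      Sweep G w β s t (k + 1) T'

theorem Sweep.mono {w : V → ℝ} {β β' : ℝ} {s t : V} {k : ℕ} {T : Finset V} (hβ : β ≤ β')
    (h : Sweep G w β s t k T) : Sweep G w β' s t k T := by
  induction h with
  | zero => exact .zero
  | succ _ hT hs ih => exact .succ ih (hT.trans hβ) hs

/-- `T` and `Tᶜ` are connected and separate `t` from `s`. -/
structure Separates (G : SimpleGraph V) (s t : V) (T : Finset V) : Prop where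
  mem : t ∈ T
  notMem : s ∉ T
  linked : Linked G T
  linked_compl : Linked G Tᶜ

/-- The part cut off from `T` is connected and contains `v`, which has a neighbour outside `T`;
hence the complement stays connected when it absorbs that part. -/
theorem Separates.step {s t : V} {T T' : Finset V} (h : Separates G s t T)
    (hs : SweepStep G t T T') : Separates G s t T' := by
  rcases hs with ⟨_, rfl⟩ | ⟨v, ⟨hv, hvt, x, hx, hxv⟩, rfl, _⟩
  · exact h
  have ht : t ∈ T.erase v := Finset.mem_erase.2 ⟨hvt.symm, h.mem⟩
  have hsub : reach G (T.erase v) t ⊆ T := (reach_subset ht).trans (Finset.erase_subset _ _)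
  refine ⟨self_mem_reach _ _, fun hs => h.notMem (hsub hs), linked_reach _ _, ?_⟩
  have heq : (reach G (T.erase v) t)ᶜ = Tᶜ ∪ (T \ reach G (T.erase v) t) := by
    ext y
    simp only [Finset.mem_compl, Finset.mem_union, Finset.mem_sdiff]
    have := @hsub y
    tauto
  rw [heq]
  refine h.linked_compl.union (h.linked.sdiff_reach hv h.mem hvt) (Finset.mem_compl.2 hx)
    (Finset.mem_sdiff.2 ⟨hv, fun hv' => ?_⟩) hxv
  simpa using reach_subset ht hv'

theorem separates_reach (hG : G.Connected) {s t : V} (hst : s ≠ t) :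
    Separates G s t (reach G (Finset.univ.erase s) t) := by
  have ht : t ∈ Finset.univ.erase s := by simp [hst.symm]
  refine ⟨self_mem_reach _ _, fun hs => by simpa using reach_subset ht hs, linked_reach _ _, ?_⟩
  rw [Finset.compl_eq_univ_sdiff]
  exact (linked_univ hG).sdiff_reach (Finset.mem_univ _) (Finset.mem_univ _) hst

theorem Sweep.separates (hG : G.Connected) {w : V → ℝ} {β : ℝ} {s t : V} (hst : s ≠ t) {k : ℕ}
    {T : Finset V} (h : Sweep G w β s t k T) : Separates G s t T := by
  induction h with
  | zero => exact separates_reach hG hst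
  | succ _ _ hs ih => exact ih.step hs

/-- A step that changes the bundle removes at least the boundary vertex, so a sweep becomes
stationary within as many steps as there are vertices. -/
theorem Sweep.card_add_le {w : V → ℝ} {β : ℝ} {s t : V} (hst : s ≠ t) (hG : G.Connected) {k : ℕ}
    {T : Finset V} (h : Sweep G w β s t k T) :
    (∀ v, ¬ IsBoundary G t T v) ∨ T.card + k + 1 ≤ Fintype.card V := by
  induction h with
  | zero =>
    right
    have h1 := Finset.card_lt_univ_of_notMem (separates_reach hG hst).notMem
    omega
  | @succ k T T' hT _ hs ih =>
    rcases hs with ⟨hb, rfl⟩ | ⟨v, hv, rfl, _⟩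
    · exact .inl hb
    · right
      have h1 := ih.resolve_left fun h => h v hv
      have ht : t ∈ T.erase v := Finset.mem_erase.2 ⟨hv.2.1.symm, (hT.separates hG hst).mem⟩
      have h2 := Finset.card_le_card (reach_subset (G := G) ht)
      have h3 := Finset.card_erase_lt_of_mem hv.1
      omega

/-- The sweep from `s` to `t` was completed with all partitions of balance at most `β`. -/
def SweepDone (G : SimpleGraph V) (w : V → ℝ) (β : ℝ) (s t : V) : Prop :=
  ∃ T, Sweep G w β s t (Fintype.card V) T

theorem SweepDone.mono {w : V → ℝ} {β β' : ℝ} {s t : V} (hβ : β ≤ β')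
    (h : SweepDone G w β s t) : SweepDone G w β' s t :=
  h.imp fun _ => Sweep.mono hβ

theorem SweepDone.exists_last (hG : G.Connected) {w : V → ℝ} {β : ℝ} {s t : V} (hst : s ≠ t)
    (h : SweepDone G w β s t) :
    ∃ k T, Sweep G w β s t k T ∧ balance w T ≤ β ∧ ∀ v, ¬ IsBoundary G t T v := by
  obtain ⟨T', h⟩ := h
  generalize hm : Fintype.card V = m at h
  cases h with
  | zero => exact absurd hm (Fintype.card_pos_iff.2 ⟨s⟩).ne'
  | @succ k T _ h hT _ =>
    refine ⟨k, T, h, hT, (h.card_add_le hst hG).resolve_right fun hc => ?_⟩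
    have := Finset.card_pos.2 ⟨t, (h.separates hG hst).mem⟩
    omega

theorem Sweep.balance_zero_le {w : V → ℝ} {β : ℝ} {s t : V} {k : ℕ} {T : Finset V}
    (h : Sweep G w β s t k T) (hT : balance w T ≤ β) :
    balance w (reach G (Finset.univ.erase s) t) ≤ β := by
  induction h with
  | zero => exact hT
  | succ _ hT' _ ih => exact ih hT'

/-- A sweep whose first bundle is heavy and whose last bundle is light has a step from a heavy to a
light bundle. -/
theorem Sweep.exists_crossing {w : V → ℝ} {β c : ℝ} {s t : V} {k : ℕ} {T : Finset V}
    (h : Sweep G w β s t k T) (hT : balance w T ≤ β) (hc : util w T ≤ c)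
    (h0 : c < util w (reach G (Finset.univ.erase s) t)) :
    ∃ j T₁ T₂, Sweep G w β s t j T₁ ∧ SweepStep G t T₁ T₂ ∧ balance w T₁ ≤ β ∧
      balance w T₂ ≤ β ∧ c < util w T₁ ∧ util w T₂ ≤ c := by
  induction h with
  | zero => exact absurd h0 (not_lt.2 hc)
  | @succ k T T' hk hT' hs ih =>
    by_cases h : util w T ≤ c
    · exact ih hT' h
    · exact ⟨k, T, T', hk, hs, hT', hT, not_le.1 h, hc⟩

end Sweep

/-! ### The 3/4 guarantee: hanging sets and the crossing step of a sweep -/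

section Approximation

variable {V : Type*} [Fintype V] [DecidableEq V] {G : SimpleGraph V} {w : V → ℝ}

theorem util_mono (hw : ∀ v, 0 ≤ w v) {X Y : Finset V} (h : X ⊆ Y) : util w X ≤ util w Y :=
  Finset.sum_le_sum_of_subset_of_nonneg h fun v _ _ => hw v

theorem util_nonneg (hw : ∀ v, 0 ≤ w v) (X : Finset V) : 0 ≤ util w X :=
  Finset.sum_nonneg fun v _ => hw v

theorem util_add_util_compl (w : V → ℝ) (X : Finset V) :
    util w X + util w Xᶜ = util w Finset.univ :=
  Finset.sum_add_sum_compl X w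

theorem util_union {X Y : Finset V} (h : Disjoint X Y) :
    util w (X ∪ Y) = util w X + util w Y :=
  Finset.sum_union h

theorem balance_compl (w : V → ℝ) (X : Finset V) : balance w Xᶜ = balance w X := by
  rw [balance, balance, compl_compl, min_comm]

theorem balance_nonneg (hw : ∀ v, 0 ≤ w v) (X : Finset V) : 0 ≤ balance w X :=
  le_min (util_nonneg hw _) (util_nonneg hw _)

theorem SweepDone.balance_reach_le (hG : G.Connected) {β : ℝ} {s t : V} (hst : s ≠ t)
    (h : SweepDone G w β s t) : balance w (reach G (Finset.univ.erase s) t) ≤ β := by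
  obtain ⟨k, T, h, hT, _⟩ := h.exists_last hG hst
  exact h.balance_zero_le hT

/-- If `X` is more balanced than all sweeps, each vertex `v` of `X` has a component of its complement
that contains `Xᶜ` and has almost all the utility. -/
theorem exists_heavy_component (hG : G.Connected) (hw : ∀ v, 0 ≤ w v) {β : ℝ}
    (hβ0 : 0 ≤ β) (hdone : ∀ s t, s ≠ t → SweepDone G w β s t) {X : Finset V} (hX : Linked G Xᶜ)
    (hβ : β < balance w X) {v : V} (hv : v ∈ X) :
    ∃ t, t ≠ v ∧ Xᶜ ⊆ reach G (Finset.univ.erase v) t ∧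
      util w (reach G (Finset.univ.erase v) t)ᶜ ≤ β := by
  have hne : Xᶜ.Nonempty := by
    by_contra h
    rw [Finset.not_nonempty_iff_eq_empty] at h
    have h3 : balance w X ≤ util w Xᶜ := min_le_right _ _
    rw [h, util, Finset.sum_empty] at h3
    linarith
  obtain ⟨t, ht⟩ := hne
  have htv : t ≠ v := fun h => Finset.mem_compl.1 ht (h ▸ hv)
  have hsub : Xᶜ ⊆ reach G (Finset.univ.erase v) t :=
    hX.subset_reach (fun y hy => by
      have : y ≠ v := fun h => Finset.mem_compl.1 hy (h ▸ hv)
      simp [this]) ht (self_mem_reach _ _)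
  refine ⟨t, htv, hsub, ?_⟩
  have h1 := (hdone v t htv.symm).balance_reach_le hG htv.symm
  have h2 := util_mono hw hsub
  have h3 : balance w X ≤ util w Xᶜ := min_le_right _ _
  -- The component contains `Xᶜ`, which is worth more than `β`; so its complement must be the light
  -- part.
  rcases min_le_iff.1 h1 with h | h <;> linarith

/-- For a vertex `b`, the set `H b` consists of `b` and the components of the complement of `b`
other than one. -/
def IsHanging (G : SimpleGraph V) (b : V) (H : Finset V) : Prop :=
  ∃ t, t ≠ b ∧ H = (reach G (Finset.univ.erase b) t)ᶜ

namespace IsHanging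

variable {b : V} {H : Finset V}

theorem mem (h : IsHanging G b H) : b ∈ H := by
  obtain ⟨t, ht, rfl⟩ := h
  rw [Finset.mem_compl]
  intro hb
  simpa using reach_subset (Finset.mem_erase.2 ⟨ht, Finset.mem_univ _⟩) hb

theorem ne (h : IsHanging G b H) {x : V} (hx : x ∉ H) : x ≠ b := fun e => hx (e ▸ h.mem)

theorem reach_eq (h : IsHanging G b H) {x : V} (hx : x ∉ H) :
    reach G (Finset.univ.erase b) x = Hᶜ := by
  obtain ⟨t, ht, rfl⟩ := h
  rw [Finset.mem_compl, not_not] at hx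
  rw [compl_compl, reach_eq_of_mem (by simp [ht]) hx]

theorem exists_notMem (h : IsHanging G b H) : ∃ x, x ∉ H := by
  obtain ⟨t, _, rfl⟩ := h
  exact ⟨t, by simp [self_mem_reach]⟩

theorem linked (h : IsHanging G b H) (hG : G.Connected) : Linked G H := by
  obtain ⟨t, ht, rfl⟩ := h
  exact (separates_reach hG ht.symm).linked_compl

theorem linked_compl (h : IsHanging G b H) : Linked G Hᶜ := by
  obtain ⟨t, ht, rfl⟩ := h
  rw [compl_compl]
  exact linked_reach _ _

/-- A connected set that avoids `b` and meets the complement of `H` is disjoint from `H`. -/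
theorem notMem_of_linked (h : IsHanging G b H) {Y : Finset V} (hY : Linked G Y) (hb : b ∉ Y)
    {x y : V} (hx : x ∈ Y) (hxH : x ∉ H) (hy : y ∈ Y) : y ∉ H := by
  rw [← Finset.mem_compl, ← h.reach_eq hxH]
  refine hY.subset_reach (fun z hz => ?_) hx (self_mem_reach _ _) hy
  have : z ≠ b := fun e => hb (e ▸ hz)
  simp [this]

theorem notMem_of_adj (h : IsHanging G b H) {x y : V} (hx : x ∉ H) (hxy : G.Adj x y)
    (hy : y ≠ b) : y ∉ H := by
  rw [← Finset.mem_compl, ← h.reach_eq hx]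
  exact reach_closed (self_mem_reach _ _) hxy (by simp [hy])

/-- Otherwise `Hᶜ` would be closed under adjacency, since an edge leaving it can only end at `b`. -/
theorem adj_base (h : IsHanging G b H) (hG : G.Connected) : ∃ x, x ∉ H ∧ G.Adj x b := by
  obtain ⟨x, hx⟩ := h.exists_notMem
  by_contra hno
  push Not at hno
  have : reach G Finset.univ x ⊆ Hᶜ := by
    refine reach_subset_of_closed (Finset.mem_compl.2 hx) fun y hy z _ hyz => ?_
    rw [Finset.mem_compl] at hy ⊢
    by_cases hz : z = b
    · exact absurd (hz ▸ hyz) (hno y hy)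
    · exact h.notMem_of_adj hy hyz hz
  exact Finset.mem_compl.1 (this (linked_univ hG x (Finset.mem_univ _) b (Finset.mem_univ _))) h.mem

end IsHanging

/-- Hanging sets with less than half of the utility are nested: if `u ∈ H b` and `u ≠ b`, then `H u`
is contained in `H b` and does not contain `b`. -/
theorem IsHanging.subset_of_mem (hG : G.Connected) (hw : ∀ v, 0 ≤ w v) {H : V → Finset V}
    (hH : ∀ b, IsHanging G b (H b)) (hlight : ∀ b, 2 * util w (H b) < util w Finset.univ)
    {b u : V} (hu : u ∈ H b) (hub : u ≠ b) : H u ⊆ H b ∧ b ∉ H u := by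
  obtain ⟨x, hx, hxb⟩ := (hH b).adj_base hG
  -- This connected set avoids `u`. Once one of its vertices is known to be outside `H u`, all of it
  -- is, which is the claim.
  have hl : Linked G ((H b)ᶜ ∪ {b}) := by
    refine (hH b).linked_compl.union ?_ (Finset.mem_compl.2 hx) (Finset.mem_singleton_self b) hxb
    exact linked_of_center (Finset.mem_singleton_self b)
      (Finset.singleton_subset_iff.2 (self_mem_reach _ _))
  have hun : u ∉ (H b)ᶜ ∪ {b} := by simp [hu, hub]
  -- Two sets lighter than half of the total cannot cover `V`.
  obtain ⟨y, hyb, hyu⟩ : ∃ y, y ∉ H b ∧ y ∉ H u := by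
    by_contra hno
    push Not at hno
    have h1 : util w Finset.univ ≤ util w (H b ∪ H u) := util_mono hw fun y _ => by
      by_cases hy : y ∈ H b
      · exact Finset.mem_union_left _ hy
      · exact Finset.mem_union_right _ (hno y hy)
    have h2 : util w (H b ∪ H u) + util w (H b ∩ H u) = util w (H b) + util w (H u) :=
      Finset.sum_union_inter
    have h3 := util_nonneg hw (H b ∩ H u)
    have := hlight b
    have := hlight u
    linarith
  have key : ∀ z ∈ (H b)ᶜ ∪ {b}, z ∉ H u := fun z hz =>
    (hH u).notMem_of_linked hl hun (Finset.mem_union_left _ (Finset.mem_compl.2 hyb)) hyu hz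
  refine ⟨fun z hz => ?_, key b (by simp)⟩
  by_contra hzb
  exact key z (Finset.mem_union_left _ (Finset.mem_compl.2 hzb)) hz

/-- A step of a sweep from `s` to `t` does not remove more than `H v` for a vertex `v` in no other
hanging set. -/
theorem SweepStep.exists_sdiff_subset {H : V → Finset V} (hH : ∀ b, IsHanging G b (H b))
    {s t : V} (hs : ∀ b, s ∈ H b → s = b) (ht : ∀ b, t ∈ H b → t = b)
    {T T' : Finset V} (hT : Separates G s t T) (hstep : SweepStep G t T T') (hne : T' ≠ T) :
    ∃ v, v ≠ s ∧ v ≠ t ∧ (∀ b, v ∈ H b → v = b) ∧ T ⊆ T' ∪ H v := by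
  rcases hstep with ⟨_, h⟩ | ⟨v, ⟨hv, hvt, x, hx, hxv⟩, hT', hmin⟩
  · exact absurd h hne
  have htv : t ∈ T.erase v := Finset.mem_erase.2 ⟨hvt.symm, hT.mem⟩
  have hvs : v ≠ s := fun e => hT.notMem (e ▸ hv)
  have htT' : t ∈ T' := hT' ▸ self_mem_reach _ _
  have hvT' : v ∉ T' := fun h => by rw [hT'] at h; simpa using reach_subset htv h
  refine ⟨v, hvs, hvt, fun b hb => ?_, fun y hy => ?_⟩
  · by_contra hvb
    -- Whichever of `T`, `Tᶜ` misses `b` is connected and contains `t` or `s`, so it lies outside `H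
    -- b`. If this is `Tᶜ`, its neighbour `v ≠ b` is outside too.
    by_cases hbT : b ∈ T
    · have hsb : s ∉ H b := fun h => hT.notMem (by rw [hs b h]; exact hbT)
      have hxb := (hH b).notMem_of_linked hT.linked_compl (by simp [hbT])
        (Finset.mem_compl.2 hT.notMem) hsb (Finset.mem_compl.2 hx)
      exact (hH b).notMem_of_adj hxb hxv hvb hb
    · have htb : t ∉ H b := fun h => hbT (by rw [← ht b h]; exact hT.mem)
      exact (hH b).notMem_of_linked hT.linked hbT hT.mem htb hv hb
  · by_contra hyn
    rw [Finset.mem_union, not_or] at hyn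
    have hyv : y ≠ v := (hH v).ne hyn.2
    have htH : t ∉ H v := fun h => hvt (ht v h).symm
    -- A walk avoiding `v` cannot leave `T \ T'`: leaving `T` needs a boundary vertex other than
    -- `v`, all of which are in `T'`, and entering `T'` would put its predecessor into the component
    -- of `t`. But this walk component is all of `(H v)ᶜ`, which contains `t`.
    have hsub : reach G (Finset.univ.erase v) y ⊆ (T \ T').erase v := by
      refine reach_subset_of_closed (by simp [hyv, hy, hyn.1]) fun a ha c hc hac => ?_
      simp only [Finset.mem_erase, Finset.mem_sdiff, Finset.mem_univ, and_true] at ha hc ⊢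
      refine ⟨hc, ?_, fun hcT' => ha.2.2 ?_⟩
      · by_contra hcT
        rcases hmin a ⟨ha.2.1, fun e => ha.2.2 (e ▸ htT'), c, hcT, hac.symm⟩ with h | h
        · exact ha.1 h
        · exact ha.2.2 h
      · rw [hT'] at hcT' ⊢
        exact reach_closed hcT' hac.symm (Finset.mem_erase.2 ⟨ha.1, ha.2.1⟩)
    have htr : t ∈ reach G (Finset.univ.erase v) y := by
      rw [(hH v).reach_eq hyn.2]; exact Finset.mem_compl.2 htH
    have := hsub htr
    simp [htT'] at this

/-- The best partition of all sweeps is within a factor `3 / 4` of the most balanced connected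
partition. -/
theorem three_mul_balance_le (hG : G.Connected) (hw : ∀ v, 0 ≤ w v) {β : ℝ} (hβ0 : 0 ≤ β)
    (hdone : ∀ s t, s ≠ t → SweepDone G w β s t) {X : Finset V} (hX : Linked G X)
    (hXc : Linked G Xᶜ) : 3 * balance w X ≤ 4 * β := by
  by_contra hcon
  push Not at hcon
  have hβ : β < balance w X := by linarith
  have hX1 : balance w X ≤ util w X := min_le_left _ _
  have hX2 : balance w X ≤ util w Xᶜ := min_le_right _ _
  have hW := util_add_util_compl w X
  have hex : ∀ v, ∃ Hv, IsHanging G v Hv ∧ util w Hv ≤ β ∧ (v ∈ X → Hv ⊆ X) ∧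
      (v ∉ X → Hv ⊆ Xᶜ) := by
    intro v
    by_cases hv : v ∈ X
    · obtain ⟨t, htv, hsub, hut⟩ := exists_heavy_component hG hw hβ0 hdone hXc hβ hv
      refine ⟨_, ⟨t, htv, rfl⟩, hut, fun _ => ?_, fun h => absurd hv h⟩
      simpa using Finset.compl_subset_compl.2 hsub
    · obtain ⟨t, htv, hsub, hut⟩ := exists_heavy_component (X := Xᶜ) hG hw hβ0 hdone
        (by rwa [compl_compl]) (by rwa [balance_compl]) (Finset.mem_compl.2 hv)
      rw [compl_compl] at hsub
      exact ⟨_, ⟨t, htv, rfl⟩, hut, fun h => absurd h hv, fun _ =>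
        Finset.compl_subset_compl.2 hsub⟩
  choose H hH hHβ hHX hHXc using hex
  have hlight : ∀ b, 2 * util w (H b) < util w Finset.univ := fun b => by
    have := hHβ b
    linarith
  -- Among the hanging sets containing `u`, a largest one has its base in no other hanging set, by
  -- nestedness.
  have hmax : ∀ u, ∃ b, (∀ v, b ∈ H v → b = v) ∧ u ∈ H b := by
    intro u
    obtain ⟨b, hb, hbmax⟩ := Finset.exists_max_image (Finset.univ.filter fun b => u ∈ H b)
      (fun b => (H b).card) ⟨u, by simp [(hH u).mem]⟩
    simp only [Finset.mem_filter, Finset.mem_univ, true_and] at hb hbmax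
    refine ⟨b, fun v hv => ?_, hb⟩
    by_contra hbv
    obtain ⟨hsub, hvb⟩ := IsHanging.subset_of_mem hG hw hH hlight hv hbv
    have := Finset.card_lt_card
      (Finset.ssubset_iff_subset_ne.2 ⟨hsub, fun e => hvb (e ▸ (hH v).mem)⟩)
    have := hbmax v (hsub hb)
    omega
  have hdisj : ∀ b b', (∀ v, b ∈ H v → b = v) → (∀ v, b' ∈ H v → b' = v) → b ≠ b' →
      Disjoint (H b) (H b') := fun b b' hb hb' hne =>
    Finset.disjoint_left.2 fun y hy => (hH b').notMem_of_linked ((hH b).linked hG)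
      (fun h => hne (hb' b h).symm) (hH b).mem (fun h => hne (hb b' h)) hy
  -- Two disjoint hanging sets on one side of `X` bound the utility of the opposite side, hence the
  -- balance.
  have hside : ∀ b b', (∀ v, b ∈ H v → b = v) → (∀ v, b' ∈ H v → b' = v) → b ≠ b' →
      (b ∈ X ↔ b' ∈ X) → balance w X ≤ util w Finset.univ - util w (H b) - util w (H b') := by
    intro b b' hb hb' hne hiff
    have hu := util_union (w := w) (hdisj b b' hb hb' hne)
    by_cases hbX : b ∈ X
    · have := util_mono hw (Finset.union_subset (hHX b hbX) (hHX b' (hiff.1 hbX)))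
      linarith
    · have := util_mono hw
        (Finset.union_subset (hHXc b hbX) (hHXc b' fun h => hbX (hiff.2 h)))
      linarith
  obtain ⟨v₀⟩ := hG.nonempty
  obtain ⟨b₀, hb₀, _⟩ := hmax v₀
  obtain ⟨s, hs, hsmax⟩ := Finset.exists_max_image
    (Finset.univ.filter fun b => ∀ v, b ∈ H v → b = v) (fun b => util w (H b))
    ⟨b₀, by simpa using hb₀⟩
  simp only [Finset.mem_filter, Finset.mem_univ, true_and] at hs hsmax
  obtain ⟨u, hu⟩ := (hH s).exists_notMem
  obtain ⟨b₁, hb₁, hub₁⟩ := hmax u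
  obtain ⟨t, ht, htmax⟩ := Finset.exists_max_image
    (Finset.univ.filter fun b => b ≠ s ∧ ∀ v, b ∈ H v → b = v) (fun b => util w (H b))
    ⟨b₁, by simpa using ⟨fun e => hu (e ▸ hub₁), hb₁⟩⟩
  simp only [Finset.mem_filter, Finset.mem_univ, true_and] at ht htmax
  obtain ⟨hts, ht⟩ := ht
  obtain ⟨k, T, hT, hTβ, hTlast⟩ := (hdone s t hts.symm).exists_last hG hts.symm
  have hTs := hT.separates hG hts.symm
  -- Without boundary vertices, `Tᶜ` is closed under adjacency away from `t`, so it contains the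
  -- component `(H t)ᶜ` of `s`.
  have hTt : T ⊆ H t := by
    have hsH : s ∉ H t := fun h => hts (hs t h).symm
    have : reach G (Finset.univ.erase t) s ⊆ Tᶜ := by
      refine reach_subset_of_closed (Finset.mem_compl.2 hTs.notMem) fun x hx y hy hxy => ?_
      rw [Finset.mem_compl] at hx ⊢
      exact fun hyT => hTlast y ⟨hyT, by simpa using hy, x, hx, hxy⟩
    rw [(hH t).reach_eq hsH] at this
    exact Finset.compl_subset_compl.1 this
  obtain ⟨j, T₁, T₂, hT₁, hstep, hT₁β, hT₂β, hT₁w, hT₂w⟩ :=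
    hT.exists_crossing (c := util w Finset.univ / 2) hTβ
      (by have := util_mono hw hTt; have := hlight t; linarith)
      (by
        rw [(hH s).reach_eq fun h => hts (ht s h)]
        have := util_add_util_compl w (H s)
        have := hlight s
        linarith)
  obtain ⟨v, hvs, hvt, hv, hsub⟩ := hstep.exists_sdiff_subset hH hs ht (hT₁.separates hG hts.symm)
    (fun e => by rw [e] at hT₂w; linarith)
  have hsv := hsmax v hv
  have hst := hsmax t ht
  have htv := htmax v ⟨hvs, hv⟩
  have h1 : util w T₁ ≤ util w T₂ + util w (H v) := by
    have h1 := util_mono hw hsub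
    have h2 : util w (T₂ ∪ H v) + util w (T₂ ∩ H v) = util w T₂ + util w (H v) :=
      Finset.sum_union_inter
    have h3 := util_nonneg hw (T₂ ∩ H v)
    linarith
  have h2 := util_add_util_compl w T₁
  have h3 := util_add_util_compl w T₂
  have h4 : util w T₁ᶜ ≤ β := by rcases min_le_iff.1 hT₁β with h | h <;> linarith
  have h5 : util w T₂ ≤ β := by rcases min_le_iff.1 hT₂β with h | h <;> linarith
  -- Pigeonhole: two of `s`, `t`, `v` are on the same side of `X`, and `H t`, `H v` are the two
  -- lightest of the three sets.
  have h6 : balance w X ≤ util w Finset.univ - util w (H t) - util w (H v) := by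
    have hst' := hside s t hs ht hts.symm
    have hsv' := hside s v hs hv hvs.symm
    have htv' := hside t v ht hv hvt.symm
    by_cases hsX : s ∈ X <;> by_cases htX : t ∈ X <;> by_cases hvX : v ∈ X <;>
      simp only [hsX, htX, hvX, iff_self, true_implies, iff_true, iff_false, not_true,
        false_implies] at hst' hsv' htv' <;>
      linarith
  linarith

end Approximation

/-! ## Running time of programs with loops over the vertices -/

/-- A syntactic measure of an expression that bounds its cost. -/
def IExp.weight : IExp → ℕ
  | .const c => 1 + c
  | .get _ i j => i.weight + j.weight + 1
  | .add x y => x.weight + y.weight + 1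
  | .sub x y => x.weight + y.weight + 1

/-- A syntactic measure of an expression that bounds its cost. -/
def VExp.weight : VExp → ℕ
  | .zero => 1
  | .get _ i j => i.weight + j.weight + 1
  | .add x y => x.weight + y.weight + 1
  | .sub x y => x.weight + y.weight + 1

/-- A syntactic measure of an expression that bounds its cost. -/
def BExp.weight : BExp → ℕ
  | .intLE x y => x.weight + y.weight + 1
  | .valLE x y => x.weight + y.weight + 1
  | .neg b => b.weight + 1
  | .conj b c => b.weight + c.weight + 1

/-- An upper bound for the cost of an elementary step of the programs below. -/
def stepBound (N : ℕ) : ℕ := 300 * (1 + 100 * (N + 20) + N) + 1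

/-- An upper bound for the cost of a program whose loops run through at most `N` vertices. -/
def Prog.bound (N : ℕ) : Prog → ℕ
  | .skip => stepBound N
  | .setInt _ _ _ _ => stepBound N
  | .setVal _ _ _ _ => stepBound N
  | .seq P Q => P.bound N + Q.bound N
  | .ite _ P Q => stepBound N + P.bound N + Q.bound N
  | .loop _ P => (N + 1) * (stepBound N + P.bound N)

/-- For a fixed program the bound is built from `N` by sums and products only; the loop nesting
determines the degree. -/
theorem Prog.exists_polynomial_bound (P : Prog) :
    ∃ p : Polynomial ℕ, ∀ N, p.eval N = P.bound N := by
  have hs : ∃ p : Polynomial ℕ, ∀ N, p.eval N = stepBound N :=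
    ⟨300 * (1 + 100 * (.X + 20) + .X) + 1, fun N => by simp [stepBound]⟩
  obtain ⟨ps, hs⟩ := hs
  induction P with
  | skip => exact ⟨ps, hs⟩
  | setInt => exact ⟨ps, hs⟩
  | setVal => exact ⟨ps, hs⟩
  | seq P Q hP hQ =>
    obtain ⟨p, hp⟩ := hP
    obtain ⟨q, hq⟩ := hQ
    exact ⟨p + q, fun N => by simp [Prog.bound, hp, hq]⟩
  | ite b P Q hP hQ =>
    obtain ⟨p, hp⟩ := hP
    obtain ⟨q, hq⟩ := hQ
    exact ⟨ps + p + q, fun N => by simp [Prog.bound, hp, hq, hs]⟩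
  | loop b P hP =>
    obtain ⟨p, hp⟩ := hP
    exact ⟨(.X + 1) * (ps + p), fun N => by simp [Prog.bound, hp, hs]⟩

/-- The integer arrays a program writes to. -/
def Prog.intWrites : Prog → List ℕ
  | .skip => []
  | .setInt a _ _ _ => [a]
  | .setVal _ _ _ _ => []
  | .seq P Q => P.intWrites ++ Q.intWrites
  | .ite _ P Q => P.intWrites ++ Q.intWrites
  | .loop _ P => P.intWrites

/-- The value arrays a program writes to. -/
def Prog.valWrites : Prog → List ℕ
  | .skip => []
  | .setInt _ _ _ _ => []
  | .setVal a _ _ _ => [a]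
  | .seq P Q => P.valWrites ++ Q.valWrites
  | .ite _ P Q => P.valWrites ++ Q.valWrites
  | .loop _ P => P.valWrites

theorem size_le_self (x : ℕ) : Nat.size x ≤ x :=
  Nat.size_le.2 Nat.lt_two_pow_self

section State

variable {R : Type}

theorem State.ints_setInt (s : State R) (a i j x b i' j' : ℕ) :
    (s.setInt a i j x).ints b i' j' = if b = a ∧ i' = i ∧ j' = j then x else s.ints b i' j' := rfl

theorem State.ints_setInt_of_ne (s : State R) {a b : ℕ} (i j x : ℕ) (h : b ≠ a) :
    (s.setInt a i j x).ints b = s.ints b := by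
  funext i' j'
  simp [State.ints_setInt, h]

@[simp] theorem State.vals_setInt (s : State R) (a i j x : ℕ) :
    (s.setInt a i j x).vals = s.vals := rfl

theorem State.vals_setVal (s : State R) (a i j : ℕ) (x : R) (b i' j' : ℕ) :
    (s.setVal a i j x).vals b i' j' = if b = a ∧ i' = i ∧ j' = j then x else s.vals b i' j' := rfl

theorem State.vals_setVal_of_ne (s : State R) {a b : ℕ} (i j : ℕ) (x : R) (h : b ≠ a) :
    (s.setVal a i j x).vals b = s.vals b := by
  funext i' j'
  simp [State.vals_setVal, h]

@[simp] theorem State.ints_setVal (s : State R) (a i j : ℕ) (x : R) :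
    (s.setVal a i j x).ints = s.ints := rfl

end State

/-! ### Arrays that a program leaves unchanged -/

section Frame

variable {R : Type} [AddCommGroup R] [LinearOrder R]

theorem Exec.ints_eq {sz : R → ℕ} {P : Prog} {s s' : State R} {t a : ℕ} (h : Exec sz P s t s')
    (ha : a ∉ P.intWrites) : s'.ints a = s.ints a := by
  induction h with
  | skip => rfl
  | setInt b i j e s => exact s.ints_setInt_of_ne _ _ _ (by simpa [Prog.intWrites] using ha)
  | setVal => rfl
  | seq _ _ h1 h2 =>
    simp only [Prog.intWrites, List.mem_append, not_or] at ha
    rw [h2 ha.2, h1 ha.1]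
  | ite_true _ _ h =>
    simp only [Prog.intWrites, List.mem_append, not_or] at ha
    exact h ha.1
  | ite_false _ _ h =>
    simp only [Prog.intWrites, List.mem_append, not_or] at ha
    exact h ha.2
  | loop_done => rfl
  | loop_step _ _ _ h1 h2 => rw [h2 ha, h1 ha]

theorem Exec.vals_eq {sz : R → ℕ} {P : Prog} {s s' : State R} {t a : ℕ} (h : Exec sz P s t s')
    (ha : a ∉ P.valWrites) : s'.vals a = s.vals a := by
  induction h with
  | skip => rfl
  | setInt => rfl
  | setVal b i j e s => exact s.vals_setVal_of_ne _ _ _ (by simpa [Prog.valWrites] using ha)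
  | seq _ _ h1 h2 =>
    simp only [Prog.valWrites, List.mem_append, not_or] at ha
    rw [h2 ha.2, h1 ha.1]
  | ite_true _ _ h =>
    simp only [Prog.valWrites, List.mem_append, not_or] at ha
    exact h ha.1
  | ite_false _ _ h =>
    simp only [Prog.valWrites, List.mem_append, not_or] at ha
    exact h ha.2
  | loop_done => rfl
  | loop_step _ _ _ h1 h2 => rw [h2 ha, h1 ha]

end Frame

/-- An instance of the division problem with a size function on values such that sums of utilities
have size at most `K`. -/
structure Problem (R : Type) [AddCommGroup R] where
  n : ℕ
  G : SimpleGraph (Fin n)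
  u : Fin 2 → Fin n → R
  sz : R → ℕ
  K : ℕ
  sum_le : ∀ i X, sz (∑ v ∈ X, u i v) ≤ K

namespace Problem

variable {R : Type} [AddCommGroup R] [LinearOrder R] (I : Problem R)

/-- The state holds the input of the problem, and all its cells are small. -/
structure Env (s : State R) : Prop where
  int_le : ∀ a i j, s.ints a i j ≤ I.n + 20
  val_le : ∀ a i j, I.sz (s.vals a i j) ≤ I.K
  size : s.ints 0 0 0 = I.n
  adj : ∀ x y : Fin I.n, 1 ≤ s.ints 1 x y ↔ I.G.Adj x y
  util : ∀ (i : Fin 2) (v : Fin I.n), s.vals 0 i v = I.u i v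

/-- The sums occurring in the expression have size at most `K`. -/
def VSized (s : State R) : VExp → Prop
  | .zero => True
  | .get _ _ _ => True
  | .add x y => VSized s x ∧ VSized s y ∧ I.sz ((VExp.add x y).eval s) ≤ I.K
  | .sub x y => VSized s x ∧ VSized s y ∧ I.sz ((VExp.sub x y).eval s) ≤ I.K

/-- The sums occurring in the test have size at most `K`. -/
def BSized (s : State R) : BExp → Prop
  | .intLE _ _ => True
  | .valLE x y => I.VSized s x ∧ I.VSized s y
  | .neg b => BSized s b
  | .conj b c => BSized s b ∧ BSized s c

variable {I}

theorem sz_zero_le (I : Problem R) : I.sz 0 ≤ I.K := by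
  simpa using I.sum_le 0 ∅

theorem IExp.eval_le {s : State R} (h : I.Env s) (e : IExp) :
    e.eval s ≤ e.weight * (I.n + 20) := by
  induction e with
  | const c => simp only [IExp.eval, IExp.weight]; nlinarith
  | get a i j =>
    have := h.int_le a (i.eval s) (j.eval s)
    simp only [IExp.eval, IExp.weight]
    nlinarith [Nat.zero_le (i.weight * (I.n + 20)), Nat.zero_le (j.weight * (I.n + 20))]
  | add x y hx hy => simp only [IExp.eval, IExp.weight]; nlinarith
  | sub x y hx hy =>
    have := Nat.sub_le (x.eval s) (y.eval s)
    simp only [IExp.eval, IExp.weight]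
    nlinarith [Nat.zero_le (y.weight * (I.n + 20))]

theorem IExp.cost_le {s : State R} (h : I.Env s) (e : IExp) {W : ℕ} (hW : e.weight ≤ W) :
    e.cost s ≤ e.weight * (1 + W * (I.n + 20)) := by
  have key : Nat.size (e.eval s) ≤ W * (I.n + 20) :=
    (size_le_self _).trans ((IExp.eval_le h e).trans (Nat.mul_le_mul_right _ hW))
  induction e with
  | const c =>
    have := size_le_self c
    simp only [IExp.cost, IExp.weight]
    nlinarith [Nat.zero_le ((1 + c) * (W * (I.n + 20)))]
  | get a i j hi hj =>
    simp only [IExp.weight] at hW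
    have hi := hi (by omega) ((size_le_self _).trans ((IExp.eval_le h i).trans
      (Nat.mul_le_mul_right _ (by omega))))
    have hj := hj (by omega) ((size_le_self _).trans ((IExp.eval_le h j).trans
      (Nat.mul_le_mul_right _ (by omega))))
    simp only [IExp.cost, IExp.weight]
    linarith
  | add i j hi hj =>
    simp only [IExp.weight] at hW
    have hi := hi (by omega) ((size_le_self _).trans ((IExp.eval_le h i).trans
      (Nat.mul_le_mul_right _ (by omega))))
    have hj := hj (by omega) ((size_le_self _).trans ((IExp.eval_le h j).trans
      (Nat.mul_le_mul_right _ (by omega))))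
    simp only [IExp.cost, IExp.weight]
    linarith
  | sub i j hi hj =>
    simp only [IExp.weight] at hW
    have hi := hi (by omega) ((size_le_self _).trans ((IExp.eval_le h i).trans
      (Nat.mul_le_mul_right _ (by omega))))
    have hj := hj (by omega) ((size_le_self _).trans ((IExp.eval_le h j).trans
      (Nat.mul_le_mul_right _ (by omega))))
    simp only [IExp.cost, IExp.weight]
    linarith

/-- Sizes of values, unlike those of natural numbers, are not controlled by the syntax: a sum of two
values of size at most `K` may be larger. Hence the hypothesis `VSized`. -/
theorem VExp.cost_le {s : State R} (h : I.Env s) (e : VExp) {W : ℕ} (hW : e.weight ≤ W)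
    (he : I.VSized s e) : e.cost I.sz s ≤ e.weight * (1 + W * (I.n + 20) + I.K) := by
  induction e with
  | zero =>
    have := I.sz_zero_le
    simp only [VExp.cost, VExp.weight]
    linarith [Nat.zero_le (W * (I.n + 20))]
  | get a i j =>
    simp only [VExp.weight] at hW
    have hi := IExp.cost_le h i (W := W) (by omega)
    have hj := IExp.cost_le h j (W := W) (by omega)
    have hv := h.val_le a (i.eval s) (j.eval s)
    simp only [VExp.cost, VExp.weight, VExp.eval]
    nlinarith [Nat.zero_le (i.weight * I.K), Nat.zero_le (j.weight * I.K),
      Nat.zero_le (W * (I.n + 20))]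
  | add x y hx hy =>
    simp only [VExp.weight] at hW
    have hx := hx (by omega) he.1
    have hy := hy (by omega) he.2.1
    have := he.2.2
    simp only [VExp.cost, VExp.weight]
    linarith [Nat.zero_le (W * (I.n + 20))]
  | sub x y hx hy =>
    simp only [VExp.weight] at hW
    have hx := hx (by omega) he.1
    have hy := hy (by omega) he.2.1
    have := he.2.2
    simp only [VExp.cost, VExp.weight]
    linarith [Nat.zero_le (W * (I.n + 20))]

theorem BExp.cost_le {s : State R} (h : I.Env s) (b : BExp) {W : ℕ} (hW : b.weight ≤ W)
    (hb : I.BSized s b) : b.cost I.sz s ≤ b.weight * (1 + W * (I.n + 20) + I.K) := by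
  induction b with
  | intLE x y =>
    simp only [BExp.weight] at hW
    have hx := IExp.cost_le h x (W := W) (by omega)
    have hy := IExp.cost_le h y (W := W) (by omega)
    simp only [BExp.cost, BExp.weight]
    nlinarith [Nat.zero_le (x.weight * I.K), Nat.zero_le (y.weight * I.K),
      Nat.zero_le (W * (I.n + 20))]
  | valLE x y =>
    simp only [BExp.weight] at hW
    have hx := VExp.cost_le h x (W := W) (by omega) hb.1
    have hy := VExp.cost_le h y (W := W) (by omega) hb.2
    simp only [BExp.cost, BExp.weight]
    linarith [Nat.zero_le (W * (I.n + 20))]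
  | neg b ih =>
    simp only [BExp.weight] at hW
    have := ih (by omega) hb
    simp only [BExp.cost, BExp.weight]
    linarith [Nat.zero_le (W * (I.n + 20))]
  | conj b c ihb ihc =>
    simp only [BExp.weight] at hW
    have := ihb (by omega) hb.1
    have := ihc (by omega) hb.2
    simp only [BExp.cost, BExp.weight]
    linarith [Nat.zero_le (W * (I.n + 20))]

/-- The 300 covers an assignment: two indices and a right-hand side, each of weight at most 100. -/
theorem mul_weight_le {k N₁ N₂ : ℕ} (hk : k ≤ 300) :
    k * (1 + 100 * (N₁ + 20) + N₂) + 1 ≤ stepBound (N₁ + N₂) := by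
  have : k * (1 + 100 * (N₁ + 20) + N₂) ≤ 300 * (1 + 100 * (N₁ + N₂ + 20) + (N₁ + N₂)) :=
    Nat.mul_le_mul hk (by omega)
  unfold stepBound
  omega

/-! ### Program logic -/

variable (I) in
/-- Started in state `s`, the program halts within its time bound in a state with `Q`. -/
def Run (P : Prog) (s : State R) (Q : State R → Prop) : Prop :=
  ∃ t s', Exec I.sz P s t s' ∧ t ≤ P.bound (I.n + I.K) ∧ I.Env s' ∧ Q s'

theorem Run.imp {P : Prog} {s : State R} {Q Q' : State R → Prop} (h : I.Run P s Q)
    (hQ : ∀ s', I.Env s' → Q s' → Q' s') : I.Run P s Q' := by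
  obtain ⟨t, s', h1, h2, h3, h4⟩ := h
  exact ⟨t, s', h1, h2, h3, hQ s' h3 h4⟩

theorem Run.frame {P : Prog} {s : State R} {Q : State R → Prop} (h : I.Run P s Q) :
    I.Run P s fun s' => Q s' ∧ (∀ a ∉ P.intWrites, s'.ints a = s.ints a) ∧
      ∀ a ∉ P.valWrites, s'.vals a = s.vals a := by
  obtain ⟨t, s', h1, h2, h3, h4⟩ := h
  exact ⟨t, s', h1, h2, h3, h4, fun _ => h1.ints_eq, fun _ => h1.vals_eq⟩

theorem Run.skip {s : State R} {Q : State R → Prop} (hs : I.Env s) (hQ : Q s) :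
    I.Run .skip s Q := by
  refine ⟨1, s, .skip s, ?_, hs, hQ⟩
  have := mul_weight_le (k := 0) (N₁ := I.n) (N₂ := I.K) (by omega)
  simp only [Prog.bound]
  omega

theorem Run.seq {P P' : Prog} {s : State R} {Q Q' : State R → Prop} (h : I.Run P s Q)
    (h' : ∀ s', I.Env s' → Q s' → I.Run P' s' Q') : I.Run (.seq P P') s Q' := by
  obtain ⟨t, s', h1, h2, h3, h4⟩ := h
  obtain ⟨t', s'', h1', h2', h3', h4'⟩ := h' s' h3 h4
  exact ⟨t + t', s'', .seq h1 h1', add_le_add h2 h2', h3', h4'⟩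

theorem Run.ite {b : BExp} {P P' : Prog} {s : State R} {Q : State R → Prop} (hs : I.Env s)
    (hw : b.weight ≤ 100) (hb : I.BSized s b) (h : b.holds s → I.Run P s Q)
    (h' : ¬ b.holds s → I.Run P' s Q) : I.Run (.ite b P P') s Q := by
  have hc := BExp.cost_le hs b hw hb
  have hc' := mul_weight_le (k := b.weight) (N₁ := I.n) (N₂ := I.K) (by omega)
  by_cases hbs : b.holds s
  · obtain ⟨t, s', h1, h2, h3, h4⟩ := h hbs
    refine ⟨_, s', .ite_true hbs h1, ?_, h3, h4⟩
    simp only [Prog.bound]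
    omega
  · obtain ⟨t, s', h1, h2, h3, h4⟩ := h' hbs
    refine ⟨_, s', .ite_false hbs h1, ?_, h3, h4⟩
    simp only [Prog.bound]
    omega

theorem Env.setInt {s : State R} (hs : I.Env s) {a i j x : ℕ} (ha : 2 ≤ a)
    (hx : x ≤ I.n + 20) : I.Env (s.setInt a i j x) where
  int_le b i' j' := by
    rw [State.ints_setInt]
    split_ifs
    exacts [hx, hs.int_le _ _ _]
  val_le := hs.val_le
  size := by rw [State.ints_setInt_of_ne _ _ _ _ (by omega)]; exact hs.size
  adj := by rw [State.ints_setInt_of_ne _ _ _ _ (by omega)]; exact hs.adj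
  util := hs.util

theorem Env.setVal {s : State R} (hs : I.Env s) {a i j : ℕ} {x : R} (ha : 1 ≤ a)
    (hx : I.sz x ≤ I.K) : I.Env (s.setVal a i j x) where
  int_le := hs.int_le
  val_le b i' j' := by
    rw [State.vals_setVal]
    split_ifs
    exacts [hx, hs.val_le _ _ _]
  size := hs.size
  adj := hs.adj
  util := by rw [State.vals_setVal_of_ne _ _ _ _ (by omega)]; exact hs.util

theorem Run.setInt {a : ℕ} {i j e : IExp} {s : State R} {Q : State R → Prop} (hs : I.Env s)
    (ha : 2 ≤ a) (hi : i.weight ≤ 100) (hj : j.weight ≤ 100) (hw : e.weight ≤ 100)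
    (he : e.eval s ≤ I.n + 20)
    (hQ : Q (s.setInt a (i.eval s) (j.eval s) (e.eval s))) : I.Run (.setInt a i j e) s Q := by
  refine ⟨_, _, .setInt a i j e s, ?_, hs.setInt ha he, hQ⟩
  have h1 := IExp.cost_le hs i hi
  have h2 := IExp.cost_le hs j hj
  have h3 := IExp.cost_le hs e hw
  have h4 := mul_weight_le (k := i.weight + j.weight + e.weight) (N₁ := I.n) (N₂ := I.K) (by omega)
  simp only [Prog.bound]
  nlinarith [Nat.zero_le ((i.weight + j.weight + e.weight) * I.K)]

theorem Run.setVal {a : ℕ} {i j : IExp} {e : VExp} {s : State R} {Q : State R → Prop}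
    (hs : I.Env s) (ha : 1 ≤ a) (hi : i.weight ≤ 100) (hj : j.weight ≤ 100) (hw : e.weight ≤ 100)
    (he : I.VSized s e) (hK : I.sz (e.eval s) ≤ I.K)
    (hQ : Q (s.setVal a (i.eval s) (j.eval s) (e.eval s))) : I.Run (.setVal a i j e) s Q := by
  refine ⟨_, _, .setVal a i j e s, ?_, hs.setVal ha hK, hQ⟩
  have h1 := IExp.cost_le hs i hi
  have h2 := IExp.cost_le hs j hj
  have h3 := VExp.cost_le hs e hw he
  have h4 := mul_weight_le (k := i.weight + j.weight + e.weight) (N₁ := I.n) (N₂ := I.K) (by omega)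
  simp only [Prog.bound]
  nlinarith [Nat.zero_le ((i.weight + j.weight) * I.K)]

end Problem

/-- The scalar variable stored in cell `(0, 0)` of an array. -/
def var (a : ℕ) : IExp := .get a (.const 0) (.const 0)

/-- Run `P` for all values of the variable `a` below the number of vertices. -/
def forAll (a : ℕ) (P : Prog) : Prog :=
  .seq (.setInt a (.const 0) (.const 0) (.const 0))
    (.loop (.neg (.intLE (var 0) (var a)))
      (.seq P (.setInt a (.const 0) (.const 0) (.add (var a) (.const 1)))))

namespace Problem

variable {R : Type} [AddCommGroup R] [LinearOrder R] {I : Problem R}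

/-- The rule for loops through the vertices, with an invariant. -/
theorem Run.forAll {a : ℕ} {P : Prog} {s : State R} (J : ℕ → State R → Prop) (hs : I.Env s)
    (ha : 2 ≤ a) (haP : a ∉ P.intWrites) (h0 : J 0 (s.setInt a 0 0 0))
    (hP : ∀ k < I.n, ∀ s', I.Env s' → s'.ints a 0 0 = k →
      (∀ b ∉ a :: P.intWrites, s'.ints b = s.ints b) →
      (∀ b ∉ P.valWrites, s'.vals b = s.vals b) → J k s' →
      I.Run P s' fun s'' => J (k + 1) (s''.setInt a 0 0 (k + 1))) :
    I.Run (forAll a P) s (J I.n) := by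
  refine Run.seq (Q := fun s' => s' = s.setInt a 0 0 0) ?_ ?_
  · exact Run.setInt hs ha (by decide) (by decide) (by decide) (by simp [IExp.eval]) rfl
  rintro _ hs0 rfl
  -- Induction on the number `m` of rounds left; the extra `stepBound` pays for the final failed
  -- test.
  have key : ∀ m k s', k + m = I.n → I.Env s' → s'.ints a 0 0 = k →
      (∀ b ∉ a :: P.intWrites, s'.ints b = s.ints b) →
      (∀ b ∉ P.valWrites, s'.vals b = s.vals b) → J k s' →
      ∃ t s'', Exec I.sz (.loop (.neg (.intLE (var 0) (var a)))
        (.seq P (.setInt a (.const 0) (.const 0) (.add (var a) (.const 1))))) s' t s'' ∧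
        t ≤ m * (stepBound (I.n + I.K) + (P.bound (I.n + I.K) + stepBound (I.n + I.K))) +
          stepBound (I.n + I.K) ∧ I.Env s'' ∧ J I.n s'' := by
    intro m
    induction m with
    | zero =>
      intro k s' hk hs' hak _ _ hJ
      refine ⟨_, s', .loop_done ?_, ?_, hs', by rwa [← hk]⟩
      · simp [BExp.holds, var, IExp.eval, hs'.size, hak]; omega
      · have h1 := BExp.cost_le hs' (.neg (.intLE (var 0) (var a))) (W := 100)
          (by simp [BExp.weight, var, IExp.weight]) trivial
        have h2 := mul_weight_le (k := (BExp.neg (.intLE (var 0) (var a))).weight) (N₁ := I.n)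
          (N₂ := I.K) (by simp [BExp.weight, var, IExp.weight])
        omega
    | succ m ih =>
      intro k s' hk hs' hak hint hval hJ
      obtain ⟨t, s₁, h1, h2, h3, ⟨h4, h5, h6⟩⟩ :=
        (hP k (by omega) s' hs' hak hint hval hJ).frame
      have hak' : s₁.ints a 0 0 = k := by rw [h5 a haP, hak]
      have hrun : I.Run (.setInt a (.const 0) (.const 0) (.add (var a) (.const 1))) s₁
          fun s₂ => s₂ = s₁.setInt a 0 0 (k + 1) :=
        Run.setInt h3 ha (by decide) (by decide) (by simp [var, IExp.weight])
          (by simp [var, IExp.eval, hak']; omega) (by simp [var, IExp.eval, hak'])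
      obtain ⟨t', s₂, h1', h2', h3', rfl⟩ := hrun
      obtain ⟨t'', s₃, h1'', h2'', h3'', h4''⟩ := ih (k + 1) _ (by omega) h3'
        (by simp [State.ints_setInt])
        (fun b hb => by
          simp only [List.mem_cons, not_or] at hb
          rw [State.ints_setInt_of_ne _ _ _ _ hb.1, h5 b hb.2, hint b (by simp [hb])])
        (fun b hb => by rw [State.vals_setInt, h6 b hb, hval b hb]) h4
      refine ⟨_, s₃, .loop_step ?_ (.seq h1 h1') h1'', ?_, h3'', h4''⟩
      · simp [BExp.holds, var, IExp.eval, hs'.size, hak]; omega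
      · have h1 := BExp.cost_le hs' (.neg (.intLE (var 0) (var a))) (W := 100)
          (by simp [BExp.weight, var, IExp.weight]) trivial
        have h2 := mul_weight_le (k := (BExp.neg (.intLE (var 0) (var a))).weight) (N₁ := I.n)
          (N₂ := I.K) (by simp [BExp.weight, var, IExp.weight])
        simp only [Prog.bound] at h2'
        rw [Nat.succ_mul]
        omega
  obtain ⟨t, s', h1, h2, h3, h4⟩ := key I.n 0 _ (by omega) hs0 (by simp [State.ints_setInt])
    (fun b hb => by
      simp only [List.mem_cons, not_or] at hb
      rw [State.ints_setInt_of_ne _ _ _ _ hb.1])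
    (fun b hb => rfl) h0
  refine ⟨t, s', h1, h2.trans ?_, h3, h4⟩
  simp only [Prog.bound]
  have h5 : I.n * (stepBound (I.n + I.K) + (P.bound (I.n + I.K) + stepBound (I.n + I.K))) ≤
      (I.n + I.K) * (stepBound (I.n + I.K) + (P.bound (I.n + I.K) + stepBound (I.n + I.K))) :=
    Nat.mul_le_mul_right _ (by omega)
  rw [Nat.succ_mul]
  omega

/-- The rule for loops through the vertices, with an invariant that depends on the set of vertices
already visited. -/
theorem Run.forAll_visited {a : ℕ} {P : Prog} {s : State R}
    (J : Set (Fin I.n) → State R → Prop) (hs : I.Env s)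
    (ha : 2 ≤ a) (haP : a ∉ P.intWrites) (h0 : J ∅ (s.setInt a 0 0 0))
    (hP : ∀ (D : Set (Fin I.n)) (v : Fin I.n), ∀ s', I.Env s' → s'.ints a 0 0 = v →
      (∀ b ∉ a :: P.intWrites, s'.ints b = s.ints b) →
      (∀ b ∉ P.valWrites, s'.vals b = s.vals b) → v ∉ D → J D s' →
      I.Run P s' fun s'' => J (insert v D) (s''.setInt a 0 0 (v + 1))) :
    I.Run (GraphFairDivision.forAll a P) s (J Set.univ) := by
  refine (Run.forAll (fun k => J {v | (v : ℕ) < k}) hs ha haP (by simpa using h0) ?_).imp ?_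
  · intro k hk s' hs' hak hint hval hJ
    refine (hP _ ⟨k, hk⟩ s' hs' hak hint hval (by simp) hJ).imp fun s'' _ h => ?_
    convert h using 1
    ext v
    simp only [Set.mem_ofPred_eq, Set.mem_insert_iff, Fin.ext_iff]
    omega
  · intro s' _ h
    convert h using 1
    ext v
    simp

/-- The rule for loops through the pairs of vertices, with an invariant that depends on the set of
pairs already visited. -/
theorem Run.forAll_forAll_visited {a b : ℕ} {P : Prog} {s : State R}
    (J : Set (Fin I.n × Fin I.n) → State R → Prop) (hs : I.Env s)
    (ha : 2 ≤ a) (hb : 2 ≤ b) (hab : a ≠ b) (haP : a ∉ P.intWrites) (hbP : b ∉ P.intWrites)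
    (hJa : ∀ D s' x, J D s' → J D (s'.setInt a 0 0 x))
    (hJb : ∀ D s' x, J D s' → J D (s'.setInt b 0 0 x)) (h0 : J ∅ s)
    (hP : ∀ (D : Set (Fin I.n × Fin I.n)) (x y : Fin I.n), ∀ s', I.Env s' → s'.ints a 0 0 = x →
      s'.ints b 0 0 = y → (∀ c ∉ a :: b :: P.intWrites, s'.ints c = s.ints c) →
      (∀ c ∉ P.valWrites, s'.vals c = s.vals c) → J D s' →
      I.Run P s' (J (insert (x, y) D))) :
    I.Run (GraphFairDivision.forAll a (GraphFairDivision.forAll b P)) s (J Set.univ) := by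
  have hw : ∀ c, c ∈ (GraphFairDivision.forAll b P).intWrites ↔ c ∈ b :: P.intWrites := by
    intro c
    simp only [GraphFairDivision.forAll, Prog.intWrites, List.mem_append, List.mem_cons,
      List.not_mem_nil]
    tauto
  have hv : ∀ c, c ∈ (GraphFairDivision.forAll b P).valWrites ↔ c ∈ P.valWrites := by
    intro c
    simp only [GraphFairDivision.forAll, Prog.valWrites, List.mem_append, List.not_mem_nil]
    tauto
  refine (Run.forAll_visited (fun D => J {p | p.1 ∈ D}) hs ha (by simp [hw, hab, haP])
    (by simpa using hJa _ _ _ h0) ?_).imp fun s' _ h => by simpa using h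
  intro D x s₁ hs₁ hx hint hval hxD hJ
  simp only [List.mem_cons, hw, hv] at hint hval
  -- Visited pairs: the finished rows together with the part `D'` of row `x`.
  refine (Run.forAll_visited (fun D' => J ({p | p.1 ∈ D} ∪ {p | p.1 = x ∧ p.2 ∈ D'})) hs₁ hb hbP
    (by simpa using hJb _ _ _ hJ) ?_).imp fun s' _ h => ?_
  · intro D' y s₂ hs₂ hy hint' hval' _ hJ'
    have hx' : s₂.ints a 0 0 = x := by rw [hint' a (by simp [hab, haP]), hx]
    refine (hP _ x y s₂ hs₂ hx' hy (fun c hc => ?_) (fun c hc => ?_) hJ').imp fun s' _ h => ?_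
    · simp only [List.mem_cons] at hc
      rw [hint' c (by simp; tauto), hint c hc]
    · rw [hval' c hc, hval c hc]
    · refine hJb _ _ _ ?_
      convert h using 1
      ext ⟨p, q⟩
      simp only [Set.mem_union, Set.mem_ofPred_eq, Set.mem_insert_iff, Prod.mk.injEq]
      tauto
  · refine hJa _ _ _ ?_
    convert h using 1
    ext ⟨p, q⟩
    simp only [Set.mem_union, Set.mem_ofPred_eq, Set.mem_insert_iff, Set.mem_univ, and_true]
    tauto

end Problem

/-! ## The program

Integer arrays: `2` output, `3` current bundle `T`, `4` component computed last, `5` best bundle,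
`6` flag.  Scalars: `10` source `s`, `11` target `t`, `14` removed vertex `v`, `12`, `13`, `15`–`18`
further counters.  Value arrays: `1`, `2` accumulators, `3` best balance. -/

/-- The vertex `e` belongs to the bundle in array `a`. -/
def isMem (a : ℕ) (e : IExp) : BExp := .intLE (.const 1) (.get a (.const 0) e)

/-- The vertices in the variables `a` and `b` are adjacent. -/
def isAdj (a b : ℕ) : BExp := .intLE (.const 1) (.get 1 (var a) (var b))

/-- The variables `a` and `b` differ. -/
def isNe (a b : ℕ) : BExp := .neg (.conj (.intLE (var a) (var b)) (.intLE (var b) (var a)))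

/-- Store in array `a` the bundle of the vertices (variable `18`) with property `b`. -/
def assign (a : ℕ) (b : BExp) : Prog :=
  forAll 18 (.ite b (.setInt a (.const 0) (var 18) (.const 1))
    (.setInt a (.const 0) (var 18) (.const 0)))

/-- Store in array `4` the component of `t` in `T` without `v`. -/
def flood : Prog :=
  .seq (assign 4 (.intLE (.const 1) (.const 0))) <|
  .seq (.setInt 4 (.const 0) (var 11) (.const 1)) <|
  forAll 15 <| forAll 16 <| forAll 17 <|
    .ite (.conj (isMem 4 (var 16)) (.conj (isAdj 16 17) (.conj (isMem 3 (var 17)) (isNe 17 14))))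
      (.setInt 4 (.const 0) (var 17) (.const 1)) .skip

/-- Compute the utilities for agent `i` of the bundle in array `a` and of its complement. -/
def sums (i a : ℕ) : Prog :=
  .seq (.setVal 1 (.const 0) (.const 0) .zero) <|
  .seq (.setVal 2 (.const 0) (.const 0) .zero) <|
  forAll 18 <|
    .ite (isMem a (var 18))
      (.setVal 1 (.const 0) (.const 0)
        (.add (.get 1 (.const 0) (.const 0)) (.get 0 (.const i) (var 18))))
      (.setVal 2 (.const 0) (.const 0)
        (.add (.get 2 (.const 0) (.const 0)) (.get 0 (.const i) (var 18))))

/-- Compare `T` with the best bundle so far. -/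
def evaluate : Prog :=
  .seq (sums 0 3) <|
  .seq (.ite (.valLE (.get 1 (.const 0) (.const 0)) (.get 2 (.const 0) (.const 0))) .skip
    (.setVal 1 (.const 0) (.const 0) (.get 2 (.const 0) (.const 0)))) <|
  .ite (.valLE (.get 3 (.const 0) (.const 0)) (.get 1 (.const 0) (.const 0)))
    (.seq (.setVal 3 (.const 0) (.const 0) (.get 1 (.const 0) (.const 0)))
      (assign 5 (isMem 3 (var 18)))) .skip

/-- The test for a boundary vertex `v` that is not in the component computed last. -/
def isNewBoundary : BExp :=
  .conj (.neg (isMem 3 (var 13))) (.conj (isAdj 13 14) (.conj (isMem 3 (var 14))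
    (.conj (isNe 14 11) (.neg (isMem 4 (var 14))))))

/-- One step of a sweep. -/
def shrink : Prog :=
  .seq (.setInt 6 (.const 0) (.const 0) (.const 0)) <|
  .seq (assign 4 (.intLE (.const 1) (.const 0))) <|
  .seq (forAll 13 <| forAll 14 <| .ite isNewBoundary
    (.seq flood (.setInt 6 (.const 0) (.const 0) (.const 1))) .skip) <|
  .ite (.intLE (.const 1) (var 6)) (assign 3 (isMem 4 (var 18))) .skip

/-- The sweep from `s` to `t`. -/
def sweep : Prog :=
  .seq (assign 3 (.intLE (.const 0) (.const 0))) <|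
  .seq (.setInt 14 (.const 0) (.const 0) (var 10)) <|
  .seq flood <|
  .seq (assign 3 (isMem 4 (var 18))) <|
  forAll 12 (.seq evaluate shrink)

/-- All sweeps; afterwards array `5` holds the best bundle found. -/
def cut : Prog := forAll 10 <| forAll 11 <| .ite (isNe 10 11) sweep .skip

/-- Give the second agent the part she prefers. -/
def chooseBundle : Prog :=
  .seq (sums 1 5) <|
  .ite (.valLE (.get 2 (.const 0) (.const 0)) (.get 1 (.const 0) (.const 0)))
    (assign 2 (isMem 5 (var 18))) (assign 2 (.neg (isMem 5 (var 18))))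

/-- The division algorithm: the first agent cuts, the second chooses. -/
def cutAndChoose : Prog := .seq cut chooseBundle

/-! ### Bundles in memory and the flooding subroutine -/

namespace Problem

variable {R : Type} [AddCommGroup R] [LinearOrder R] {I : Problem R}

variable (I) in
/-- The bundle stored in array `a`. -/
def bundle (s : State R) (a : ℕ) : Finset (Fin I.n) :=
  Finset.univ.filter fun v => 1 ≤ s.ints a 0 v

theorem mem_bundle {s : State R} {a : ℕ} {v : Fin I.n} :
    v ∈ I.bundle s a ↔ 1 ≤ s.ints a 0 v := by
  simp [bundle]

theorem bundle_congr {s s' : State R} {a : ℕ} (h : s'.ints a = s.ints a) :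
    I.bundle s' a = I.bundle s a := by
  simp [bundle, h]

theorem bundle_setInt_of_ne (s : State R) {a b : ℕ} (i j x : ℕ) (h : b ≠ a) :
    I.bundle (s.setInt a i j x) b = I.bundle s b :=
  bundle_congr (s.ints_setInt_of_ne _ _ _ h)

theorem bundle_setInt_one (s : State R) (a : ℕ) (v : Fin I.n) :
    I.bundle (s.setInt a 0 v 1) a = insert v (I.bundle s a) := by
  ext x
  simp only [mem_bundle, State.ints_setInt, Finset.mem_insert, Fin.ext_iff, true_and]
  split_ifs <;> simp_all

theorem bundle_eq {s : State R} {a : ℕ} {X : Finset (Fin I.n)}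
    (h : ∀ v : Fin I.n, s.ints a 0 v = if v ∈ X then 1 else 0) : I.bundle s a = X := by
  ext v
  rw [mem_bundle, h]
  split_ifs <;> simp_all

@[simp] theorem eval_var (s : State R) (a : ℕ) : (var a).eval s = s.ints a 0 0 := rfl

theorem holds_isMem {s : State R} {a : ℕ} {e : IExp} {v : Fin I.n} (h : e.eval s = v) :
    (isMem a e).holds s ↔ v ∈ I.bundle s a := by
  simp [isMem, BExp.holds, IExp.eval, h, mem_bundle]

theorem holds_isAdj {s : State R} (hs : I.Env s) {a b : ℕ} {x y : Fin I.n}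
    (hx : s.ints a 0 0 = x) (hy : s.ints b 0 0 = y) : (isAdj a b).holds s ↔ I.G.Adj x y := by
  simp [isAdj, BExp.holds, IExp.eval, hx, hy, hs.adj]

theorem holds_isNe {s : State R} {a b : ℕ} {x y : Fin I.n}
    (hx : s.ints a 0 0 = x) (hy : s.ints b 0 0 = y) : (isNe a b).holds s ↔ x ≠ y := by
  simp only [isNe, BExp.holds, eval_var, hx, hy, ne_eq, Fin.ext_iff]
  omega

theorem run_assign {a : ℕ} {b : BExp} {s : State R} (hs : I.Env s) (ha : 2 ≤ a) (ha' : a ≠ 18)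
    (hw : b.weight ≤ 100) (hsz : ∀ s', I.BSized s' b) (X : Finset (Fin I.n))
    (hb : ∀ s', I.Env s' → ∀ v : Fin I.n, s'.ints 18 0 0 = v →
      (∀ c, c ≠ 18 → c ≠ a → s'.ints c = s.ints c) → (b.holds s' ↔ v ∈ X)) :
    I.Run (assign a b) s fun s' => ∀ v : Fin I.n, s'.ints a 0 v = if v ∈ X then 1 else 0 := by
  refine (Run.forAll_visited (fun D s' => ∀ v ∈ D, s'.ints a 0 v = if v ∈ X then 1 else 0) hs
    (by omega) (by simp [Prog.intWrites, ha'.symm]) (by simp) ?_).imp fun s' _ h v => h v trivial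
  intro D v s' hs' hv hint _ _ hD
  have hb' := hb s' hs' v hv fun c h1 h2 => hint c (by simp [Prog.intWrites, h1, h2])
  have key : ∀ x, (x = if v ∈ X then 1 else 0) → ∀ y ∈ insert v D,
      ((s'.setInt a 0 v x).setInt 18 0 0 (v + 1)).ints a 0 y = if y ∈ X then 1 else 0 := by
    intro x hx y hy
    rw [State.ints_setInt_of_ne _ _ _ _ ha', State.ints_setInt]
    by_cases hyv : y = v
    · simp [hyv, hx]
    · simpa [Fin.val_ne_of_ne hyv] using hD y (hy.resolve_left hyv)
  refine Run.ite hs' hw (hsz s') (fun h => ?_) (fun h => ?_)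
  · refine Run.setInt hs' ha (by decide) (by decide) (by decide) (by simp [IExp.eval]) ?_
    simpa only [IExp.eval, eval_var, hv] using key 1 (by simp [hb'.1 h])
  · refine Run.setInt hs' ha (by decide) (by decide) (by decide) (by simp [IExp.eval]) ?_
    simpa only [IExp.eval, eval_var, hv] using key 0 (by simp [mt hb'.2 h])

theorem run_flood {s : State R} (hs : I.Env s) {t v : Fin I.n} (ht : s.ints 11 0 0 = t)
    (hv : s.ints 14 0 0 = v) :
    I.Run flood s fun s' => I.bundle s' 4 = reach I.G ((I.bundle s 3).erase v) t := by
  refine Run.seq (run_assign hs (a := 4) (by decide) (by decide) (by decide)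
    (fun _ => by exact trivial) ∅ fun s' _ v _ _ => by simp [BExp.holds, IExp.eval]).frame ?_
  rintro s₁ hs₁ ⟨h4, hint₁, -⟩
  have h4 := bundle_eq h4
  have ht₁ : s₁.ints 11 0 0 = t := by rw [hint₁ 11 (by decide), ht]
  have hv₁ : s₁.ints 14 0 0 = v := by rw [hint₁ 14 (by decide), hv]
  have hT₁ : I.bundle s₁ 3 = I.bundle s 3 := bundle_congr (hint₁ 3 (by decide))
  generalize I.bundle s 3 = T at hT₁
  refine Run.seq (Q := fun s' => s' = s₁.setInt 4 0 t 1) (Run.setInt hs₁ (by decide) (by decide)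
    (by decide) (by decide) (by simp [IExp.eval]) (by simp [IExp.eval, ht₁])) ?_
  rintro s₂ hs₂ rfl
  -- Each round over all pairs either adds a vertex or shows that the bundle is closed. After `n`
  -- rounds the second alternative would require `n + 1` vertices.
  refine (Run.forAll (fun k s' => I.bundle s' 4 ⊆ reach I.G (T.erase v) t ∧ t ∈ I.bundle s' 4 ∧
    (I.bundle s' 4 = reach I.G (T.erase v) t ∨ k + 1 ≤ (I.bundle s' 4).card)) hs₂ (by decide)
    (by decide) ?_ ?_).imp ?_
  · rw [bundle_setInt_of_ne _ _ _ _ (by decide), bundle_setInt_one, h4]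
    simp [self_mem_reach]
  · intro k _ s₃ hs₃ _ hint₃ _ hJ
    have hT₃ : I.bundle s₃ 3 = T := by
      rw [← hT₁]
      exact bundle_congr ((hint₃ 3 (by decide)).trans (State.ints_setInt_of_ne _ _ _ _ (by decide)))
    have hv₃ : s₃.ints 14 0 0 = v := by
      rw [hint₃ 14 (by decide), State.ints_setInt_of_ne _ _ _ _ (by decide), hv₁]
    refine (Run.forAll_forAll_visited (fun D s' => I.bundle s₃ 4 ⊆ I.bundle s' 4 ∧
      I.bundle s' 4 ⊆ reach I.G (T.erase v) t ∧ ∀ p ∈ D, p.1 ∈ I.bundle s₃ 4 → I.G.Adj p.1 p.2 →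
        p.2 ∈ T.erase v → p.2 ∈ I.bundle s' 4) hs₃ (by decide) (by decide) (by decide) (by decide)
      (by decide) ?_ ?_ ?_ ?_).imp ?_
    · intro D s' x h
      rwa [bundle_setInt_of_ne _ _ _ _ (by decide)]
    · intro D s' x h
      rwa [bundle_setInt_of_ne _ _ _ _ (by decide)]
    · exact ⟨subset_rfl, hJ.1, by simp⟩
    · intro D x y s₄ hs₄ hx hy hint₄ _ hJ₄
      have hv₄ : s₄.ints 14 0 0 = v := by rw [hint₄ 14 (by decide), hv₃]
      have hT₄ : I.bundle s₄ 3 = T := (bundle_congr (hint₄ 3 (by decide))).trans hT₃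
      have hholds : (BExp.conj (isMem 4 (var 16)) (.conj (isAdj 16 17)
          (.conj (isMem 3 (var 17)) (isNe 17 14)))).holds s₄ ↔
          x ∈ I.bundle s₄ 4 ∧ I.G.Adj x y ∧ y ∈ T.erase v := by
        simp only [BExp.holds, holds_isMem (I := I) (e := var 16) hx,
          holds_isMem (I := I) (e := var 17) hy, holds_isAdj hs₄ hx hy, holds_isNe hy hv₄, hT₄,
          Finset.mem_erase, ne_eq]
        tauto
      refine Run.ite hs₄ (by decide) (by simp [BSized, isMem, isAdj, isNe]) (fun h => ?_)
        (fun h => ?_)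
      · rw [hholds] at h
        refine Run.setInt hs₄ (by decide) (by decide) (by decide) (by decide)
          (by simp [IExp.eval]) ?_
        simp only [IExp.eval, eval_var, hy, bundle_setInt_one]
        refine ⟨hJ₄.1.trans (Finset.subset_insert _ _), Finset.insert_subset
          (reach_closed (hJ₄.2.1 h.1) h.2.1 h.2.2) hJ₄.2.1, ?_⟩
        rintro p (rfl | hp) h1 h2 h3
        · exact Finset.mem_insert_self _ _
        · exact Finset.mem_insert_of_mem (hJ₄.2.2 p hp h1 h2 h3)
      · rw [hholds] at h
        refine Run.skip hs₄ ⟨hJ₄.1, hJ₄.2.1, ?_⟩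
        rintro p (rfl | hp) h1 h2 h3
        · exact absurd ⟨hJ₄.1 h1, h2, h3⟩ h
        · exact hJ₄.2.2 p hp h1 h2 h3
    · rintro s₅ _ ⟨h1, h2, h3⟩
      rw [bundle_setInt_of_ne _ _ _ _ (by decide)]
      refine ⟨h2, h1 hJ.2.1, ?_⟩
      by_cases heq : I.bundle s₅ 4 = I.bundle s₃ 4
      · refine .inl (Finset.Subset.antisymm h2 (reach_subset_of_closed (h1 hJ.2.1) ?_))
        intro x hx y hy hxy
        exact h3 (x, y) trivial (heq ▸ hx) hxy hy
      · rcases hJ.2.2 with h | h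
        · exact .inl (Finset.Subset.antisymm h2 (h ▸ h1))
        · have := Finset.card_lt_card (Finset.ssubset_iff_subset_ne.2 ⟨h1, Ne.symm heq⟩)
          exact .inr (by omega)
  · rintro s' _ ⟨_, _, h | h⟩
    · exact h
    · have := Finset.card_le_univ (I.bundle s' 4)
      simp only [Fintype.card_fin] at this
      omega

end Problem

/-- The component of `t` left after deleting `v` is connected and avoids `v'`, so it survives
deleting `v'`; as `T` is connected, it also touches `v`. This is why replacing `v` by a boundary
vertex `v'` outside the component only enlarges the component. -/
theorem Linked.reach_erase_subset {V : Type*} [Fintype V] [DecidableEq V] {G : SimpleGraph V}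
    {T : Finset V} {t v v' : V} (hT : Linked G T) (ht : t ∈ T) (hv : v ∈ T) (hvt : v ≠ t)
    (hv' : v' ∉ reach G (T.erase v) t) :
    reach G (T.erase v) t ⊆ reach G (T.erase v') t ∧
      (v ≠ v' → v ∈ reach G (T.erase v') t) := by
  have htv : t ∈ T.erase v := Finset.mem_erase.2 ⟨hvt.symm, ht⟩
  have hsub : reach G (T.erase v) t ⊆ reach G (T.erase v') t := by
    refine (linked_reach _ _).subset_reach (fun x hx => Finset.mem_erase.2 ⟨fun e => hv' (e ▸ hx),
      Finset.mem_of_mem_erase (reach_subset htv hx)⟩) (self_mem_reach _ _) (self_mem_reach _ _)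
  refine ⟨hsub, fun hne => ?_⟩
  by_contra hcon
  have : reach G T t ⊆ reach G (T.erase v) t := by
    refine reach_subset_of_closed (self_mem_reach _ _) fun x hx y hy hxy => ?_
    by_cases hyv : y = v
    · exact absurd (reach_closed (hsub hx) (hyv ▸ hxy) (Finset.mem_erase.2 ⟨hne, hv⟩)) hcon
    · exact reach_closed hx hxy (Finset.mem_erase.2 ⟨hyv, hy⟩)
  exact hcon (hsub (this (hT t ht v hv)))

namespace Problem

variable {R : Type} [AddCommGroup R] [LinearOrder R] {I : Problem R}

theorem run_sums {s : State R} (hs : I.Env s) (i : Fin 2) {a : ℕ} (ha : a ≠ 18) :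
    I.Run (sums i a) s fun s' => s'.vals 1 0 0 = ∑ v ∈ I.bundle s a, I.u i v ∧
      s'.vals 2 0 0 = ∑ v ∈ (I.bundle s a)ᶜ, I.u i v := by
  classical
  refine Run.seq (Q := fun s' => s' = s.setVal 1 0 0 0) (Run.setVal hs (by decide) (by decide)
    (by decide) (by decide) trivial I.sz_zero_le rfl) ?_
  rintro s₁ hs₁ rfl
  refine Run.seq (Q := fun s' => s' = (s.setVal 1 0 0 0).setVal 2 0 0 0) (Run.setVal hs₁
    (by decide) (by decide) (by decide) (by decide) trivial I.sz_zero_le rfl) ?_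
  rintro s₂ hs₂ rfl
  refine (Run.forAll_visited (fun D s' =>
    s'.vals 1 0 0 = ∑ v ∈ (I.bundle s a).filter (· ∈ D), I.u i v ∧
    s'.vals 2 0 0 = ∑ v ∈ (I.bundle s a)ᶜ.filter (· ∈ D), I.u i v) hs₂ (by decide)
    (by simp [Prog.intWrites]) (by simp [State.vals_setVal]) ?_).imp
    fun s' _ h => by simpa using h
  intro D v s₃ hs₃ hv hint _ hvD hJ
  have hB : I.bundle s₃ a = I.bundle s a :=
    bundle_congr (hint a (by simp [Prog.intWrites, ha]))
  -- The accumulators always hold a sum of utilities over a set of vertices, so `sum_le` bounds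
  -- their size.
  have hins : ∀ X : Finset (Fin I.n), v ∈ X → ∑ y ∈ X.filter (· ∈ D), I.u i y + I.u i v =
      ∑ y ∈ X.filter (· ∈ insert v D), I.u i y := by
    intro X hX
    have : X.filter (· ∈ insert v D) = insert v (X.filter (· ∈ D)) := by
      ext y
      simp only [Finset.mem_filter, Set.mem_insert_iff, Finset.mem_insert]
      constructor
      · tauto
      · rintro (rfl | h)
        · exact ⟨hX, .inl rfl⟩
        · exact ⟨h.1, .inr h.2⟩
    rw [this, Finset.sum_insert (by simp [hvD]), add_comm]
  have hnot : ∀ X : Finset (Fin I.n), v ∉ X →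
      X.filter (· ∈ D) = X.filter (· ∈ insert v D) := by
    intro X hX
    ext y
    simp only [Finset.mem_filter, Set.mem_insert_iff]
    constructor
    · tauto
    · rintro ⟨h, rfl | h'⟩
      · exact absurd h hX
      · exact ⟨h, h'⟩
  have hw : IExp.weight (.const (i : ℕ)) ≤ 2 := by
    simp only [IExp.weight]
    omega
  have heval : s₃.vals 0 i v = I.u i v := hs₃.util i v
  refine Run.ite hs₃ (by simp [BExp.weight, isMem, IExp.weight, var]) (by simp [BSized, isMem])
    (fun h => ?_) (fun h => ?_)
  · rw [holds_isMem (I := I) (e := var 18) hv, hB] at h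
    have hval : s₃.vals 1 0 0 + s₃.vals 0 i v =
        ∑ y ∈ (I.bundle s a).filter (· ∈ insert v D), I.u i y := by
      rw [hJ.1, heval, hins _ h]
    have hsz : I.sz (s₃.vals 1 0 0 + s₃.vals 0 i v) ≤ I.K := hval ▸ I.sum_le i _
    refine Run.setVal hs₃ (by decide) (by decide) (by decide)
      (by simp only [VExp.weight, IExp.weight, var] at *; omega) ⟨trivial, trivial, ?_⟩ ?_ ?_
    · simpa [VExp.eval, IExp.eval, hv] using hsz
    · simpa [VExp.eval, IExp.eval, hv] using hsz
    · simp [VExp.eval, IExp.eval, hv, State.vals_setVal, hval, hJ.2, hnot (I.bundle s a)ᶜ (by simpa using h)]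
  · rw [holds_isMem (I := I) (e := var 18) hv, hB] at h
    have hval : s₃.vals 2 0 0 + s₃.vals 0 i v =
        ∑ y ∈ (I.bundle s a)ᶜ.filter (· ∈ insert v D), I.u i y := by
      rw [hJ.2, heval, hins _ (by simpa using h)]
    have hsz : I.sz (s₃.vals 2 0 0 + s₃.vals 0 i v) ≤ I.K := hval ▸ I.sum_le i _
    refine Run.setVal hs₃ (by decide) (by decide) (by decide)
      (by simp only [VExp.weight, IExp.weight, var] at *; omega) ⟨trivial, trivial, ?_⟩ ?_ ?_
    · simpa [VExp.eval, IExp.eval, hv] using hsz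
    · simpa [VExp.eval, IExp.eval, hv] using hsz
    · simp [VExp.eval, IExp.eval, hv, State.vals_setVal, hval, hJ.1, hnot (I.bundle s a) h]

theorem run_shrink {s : State R} (hs : I.Env s) {t : Fin I.n} (ht : s.ints 11 0 0 = t)
    (hT : Linked I.G (I.bundle s 3)) (htT : t ∈ I.bundle s 3) :
    I.Run shrink s fun s' => SweepStep I.G t (I.bundle s 3) (I.bundle s' 3) := by
  refine Run.seq (Q := fun s' => s' = s.setInt 6 0 0 0) (Run.setInt hs (by decide) (by decide)
    (by decide) (by decide) (by simp [IExp.eval]) rfl) ?_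
  rintro s₁ hs₁ rfl
  refine Run.seq (run_assign hs₁ (a := 4) (by decide) (by decide) (by decide)
    (fun _ => by exact trivial) ∅ fun s' _ v _ _ => by simp [BExp.holds, IExp.eval]).frame ?_
  rintro s₂ hs₂ ⟨h4, hint₂, -⟩
  have h4 := bundle_eq h4
  have h6 : s₂.ints 6 0 0 = 0 := by rw [hint₂ 6 (by decide)]; simp [State.ints_setInt]
  have ht₂ : s₂.ints 11 0 0 = t := by
    rw [hint₂ 11 (by decide), State.ints_setInt_of_ne _ _ _ _ (by decide), ht]
  have hT₂ : I.bundle s₂ 3 = I.bundle s 3 :=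
    bundle_congr ((hint₂ 3 (by decide)).trans (State.ints_setInt_of_ne _ _ _ _ (by decide)))
  generalize I.bundle s 3 = T at hT htT hT₂
  -- Invariant: either no boundary vertex was seen, or array `4` is the component for some boundary
  -- vertex `v` and contains every other one seen so far. One pass suffices because the stored
  -- component never shrinks.
  have hloop := Run.forAll_forAll_visited (I := I) (a := 13) (b := 14)
    (P := .ite isNewBoundary (.seq flood (.setInt 6 (.const 0) (.const 0) (.const 1))) .skip)
    (fun D s' =>
      (s'.ints 6 0 0 = 0 ∧ I.bundle s' 4 = ∅ ∧
        ∀ p ∈ D, ¬ (p.1 ∉ T ∧ I.G.Adj p.1 p.2 ∧ p.2 ∈ T ∧ p.2 ≠ t)) ∨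
      (s'.ints 6 0 0 = 1 ∧ ∃ v, IsBoundary I.G t T v ∧ I.bundle s' 4 = reach I.G (T.erase v) t ∧
        ∀ p ∈ D, p.1 ∉ T ∧ I.G.Adj p.1 p.2 ∧ p.2 ∈ T ∧ p.2 ≠ t →
          p.2 = v ∨ p.2 ∈ I.bundle s' 4)) hs₂
    (by decide) (by decide) (by decide) (by decide) (by decide) ?_ ?_ ?_ ?_
  · refine Run.seq hloop.frame ?_
    rintro s₃ hs₃ ⟨hJ, hint₃, -⟩
    have hT₃ : I.bundle s₃ 3 = T := (bundle_congr (hint₃ 3 (by decide))).trans hT₂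
    refine Run.ite hs₃ (by decide) trivial (fun h => ?_) (fun h => ?_)
    · simp only [BExp.holds, IExp.eval, eval_var] at h
      obtain ⟨h0, _⟩ | ⟨_, v, hv, hbv, hall⟩ := hJ
      · omega
      refine (run_assign hs₃ (a := 3) (by decide) (by decide) (by decide)
        (fun _ => by exact trivial) (I.bundle s₃ 4) fun s' _ v hv hint => ?_).imp fun s' _ h => ?_
      · rw [holds_isMem (I := I) (e := var 18) hv, bundle_congr (hint 4 (by decide) (by decide))]
      · rw [bundle_eq h]
        refine .inr ⟨v, hv, hbv, ?_⟩
        rintro y ⟨hy, hyt, x, hx, hxy⟩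
        exact hall (x, y) trivial ⟨hx, hxy, hy, hyt⟩
    · simp only [BExp.holds, IExp.eval, eval_var] at h
      obtain ⟨_, _, hall⟩ | ⟨h1, _⟩ := hJ
      · refine Run.skip hs₃ (.inl ⟨?_, hT₃⟩)
        rintro y ⟨hy, hyt, x, hx, hxy⟩
        exact hall (x, y) trivial ⟨hx, hxy, hy, hyt⟩
      · omega
  · intro D s' x h
    rwa [bundle_setInt_of_ne _ _ _ _ (by decide), State.ints_setInt_of_ne _ _ _ _ (by decide)]
  · intro D s' x h
    rwa [bundle_setInt_of_ne _ _ _ _ (by decide), State.ints_setInt_of_ne _ _ _ _ (by decide)]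
  · exact .inl ⟨h6, h4, by simp⟩
  · intro D x v s₃ hs₃ hx hv hint₃ _ hJ
    have ht₃ : s₃.ints 11 0 0 = t := by rw [hint₃ 11 (by decide), ht₂]
    have hT₃ : I.bundle s₃ 3 = T := (bundle_congr (hint₃ 3 (by decide))).trans hT₂
    have hholds : isNewBoundary.holds s₃ ↔
        (x ∉ T ∧ I.G.Adj x v ∧ v ∈ T ∧ v ≠ t) ∧ v ∉ I.bundle s₃ 4 := by
      simp only [isNewBoundary, BExp.holds, holds_isMem (I := I) (e := var 13) hx,
        holds_isMem (I := I) (e := var 14) hv, holds_isAdj hs₃ hx hv, holds_isNe hv ht₃, hT₃]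
      tauto
    refine Run.ite hs₃ (by decide) (by simp [isNewBoundary, BSized, isMem, isAdj, isNe])
      (fun h => ?_) (fun h => ?_)
    · rw [hholds] at h
      obtain ⟨⟨hxT, hxv, hvT, hvt⟩, hv4⟩ := h
      refine Run.seq (run_flood hs₃ ht₃ hv) ?_
      intro s₄ hs₄ h4'
      rw [hT₃] at h4'
      refine Run.setInt hs₄ (by decide) (by decide) (by decide) (by decide) (by simp [IExp.eval]) ?_
      simp only [IExp.eval]
      rw [bundle_setInt_of_ne _ _ _ _ (by decide), h4']
      refine .inr ⟨by simp [State.ints_setInt], v, ⟨hvT, hvt, x, hxT, hxv⟩, rfl, ?_⟩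
      rintro p (rfl | hp) hpc
      · exact .inl rfl
      obtain ⟨_, _, hall⟩ | ⟨_, v', hv', hb', hall⟩ := hJ
      · exact absurd hpc (hall p hp)
      · rw [hb'] at hv4 hall
        have hgrow := hT.reach_erase_subset htT hv'.1 hv'.2.1 hv4
        rcases hall p hp hpc with h | h
        · by_cases hvv : v' = v
          · exact .inl (h.trans hvv)
          · exact .inr (h ▸ hgrow.2 hvv)
        · exact .inr (hgrow.1 h)
    · rw [hholds] at h
      refine Run.skip hs₃ ?_
      obtain ⟨h0, hb, hall⟩ | ⟨h1, v', hv', hb', hall⟩ := hJ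
      · refine .inl ⟨h0, hb, ?_⟩
        rintro p (rfl | hp)
        · exact fun hc => h ⟨hc, by simp [hb]⟩
        · exact hall p hp
      · refine .inr ⟨h1, v', hv', hb', ?_⟩
        rintro p (rfl | hp) hpc
        · exact .inr (by by_contra hc; exact h ⟨hpc, hc⟩)
        · exact hall p hp hpc

/-! ### Correctness of cutting and choosing -/

section Values

variable (φ : R →+ ℝ)

variable (I) in
/-- The real utilities of an agent. -/
def weight (i : Fin 2) (v : Fin I.n) : ℝ := φ (I.u i v)

theorem map_sum_eq_util (i : Fin 2) (X : Finset (Fin I.n)) :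
    φ (∑ v ∈ X, I.u i v) = util (I.weight φ i) X := by
  simp [util, weight]

variable (I) in
/-- Array `5` holds one part of a connected partition and value array `3` its balance. -/
structure HoldsBest (s : State R) : Prop where
  eq : φ (s.vals 3 0 0) = balance (I.weight φ 0) (I.bundle s 5)
  linked : Linked I.G (I.bundle s 5)
  linked_compl : Linked I.G (I.bundle s 5)ᶜ

variable {φ}

theorem HoldsBest.congr {s s' : State R} (h : I.HoldsBest φ s) (h5 : s'.ints 5 = s.ints 5)
    (h3 : s'.vals 3 = s.vals 3) : I.HoldsBest φ s' := by
  have hb := bundle_congr (I := I) h5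
  exact ⟨by rw [h3, hb, h.eq], hb ▸ h.linked, hb ▸ h.linked_compl⟩

theorem run_evaluate (hφ : StrictMono φ) {s : State R} (hs : I.Env s) (hb : I.HoldsBest φ s)
    (hT : Linked I.G (I.bundle s 3)) (hTc : Linked I.G (I.bundle s 3)ᶜ) :
    I.Run evaluate s fun s' => I.HoldsBest φ s' ∧
      balance (I.weight φ 0) (I.bundle s 3) ≤ φ (s'.vals 3 0 0) ∧
      φ (s.vals 3 0 0) ≤ φ (s'.vals 3 0 0) := by
  refine Run.seq (run_sums hs 0 (a := 3) (by decide)).frame ?_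
  rintro s₁ hs₁ ⟨⟨h1, h2⟩, hint₁, hval₁⟩
  have hb₁ := hb.congr (hint₁ 5 (by decide)) (hval₁ 3 (by decide))
  have hT₁ : I.bundle s₁ 3 = I.bundle s 3 := bundle_congr (hint₁ 3 (by decide))
  rw [← hval₁ 3 (by decide)]
  generalize I.bundle s 3 = T at *
  refine Run.seq (Q := fun s' => φ (s'.vals 1 0 0) = balance (I.weight φ 0) T ∧
    s'.ints = s₁.ints ∧ s'.vals 3 = s₁.vals 3) ?_ ?_
  · refine Run.ite hs₁ (by decide) ⟨trivial, trivial⟩ (fun h => ?_) (fun h => ?_)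
    · simp only [BExp.holds, VExp.eval, IExp.eval, h1, h2] at h
      have h := hφ.monotone h
      rw [map_sum_eq_util, map_sum_eq_util] at h
      exact Run.skip hs₁ ⟨by rw [h1, map_sum_eq_util, balance, min_eq_left h], rfl, rfl⟩
    · simp only [BExp.holds, VExp.eval, IExp.eval, h1, h2, not_le] at h
      have h := hφ h
      rw [map_sum_eq_util, map_sum_eq_util] at h
      refine Run.setVal hs₁ (by decide) (by decide) (by decide) (by decide) trivial
        (hs₁.val_le _ _ _) ⟨?_, rfl, State.vals_setVal_of_ne _ _ _ _ (by decide)⟩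
      simp only [VExp.eval, IExp.eval, State.vals_setVal, and_self, if_true]
      rw [h2, map_sum_eq_util, balance, min_eq_right h.le]
  rintro s₂ hs₂ ⟨hbal, hint₂, hval₂⟩
  have hb₂ := hb₁.congr (congrFun hint₂ 5) hval₂
  have hT₂ : I.bundle s₂ 3 = T := (bundle_congr (congrFun hint₂ 3)).trans hT₁
  rw [← hval₂]
  refine Run.ite hs₂ (by decide) ⟨trivial, trivial⟩ (fun h => ?_) (fun h => ?_)
  · simp only [BExp.holds, VExp.eval, IExp.eval] at h
    have h := hφ.monotone h
    refine Run.seq (Q := fun s' => s' = s₂.setVal 3 0 0 (s₂.vals 1 0 0)) (Run.setVal hs₂ (by decide)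
      (by decide) (by decide) (by decide) trivial (hs₂.val_le _ _ _) rfl) ?_
    rintro s₃ hs₃ rfl
    refine (run_assign hs₃ (a := 5) (by decide) (by decide) (by decide)
      (fun _ => by exact trivial) T fun s' _ v hv hint => ?_).frame.imp ?_
    · rw [holds_isMem (I := I) (e := var 18) hv, bundle_congr (hint 3 (by decide) (by decide)),
        ← hT₂]
      rfl
    · rintro s₄ _ ⟨h5, _, hval₄⟩
      have h3 : φ (s₄.vals 3 0 0) = balance (I.weight φ 0) T := by
        rw [hval₄ 3 (by decide)]
        simpa [State.vals_setVal] using hbal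
      have h5 := bundle_eq h5
      exact ⟨⟨h5 ▸ h3, h5 ▸ hT, h5 ▸ hTc⟩, h3.ge, by rw [h3, ← hbal]; exact h⟩
  · simp only [BExp.holds, VExp.eval, IExp.eval, not_le] at h
    have h := hφ h
    exact Run.skip hs₂ ⟨hb₂, by rw [← hbal]; exact h.le, le_rfl⟩

theorem run_sweep (hφ : StrictMono φ) (hG : I.G.Connected) {s : State R} (hs : I.Env s)
    (hb : I.HoldsBest φ s) {x t : Fin I.n} (hx : s.ints 10 0 0 = x) (ht : s.ints 11 0 0 = t)
    (hxt : x ≠ t) :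
    I.Run sweep s fun s' => I.HoldsBest φ s' ∧ φ (s.vals 3 0 0) ≤ φ (s'.vals 3 0 0) ∧
      SweepDone I.G (I.weight φ 0) (φ (s'.vals 3 0 0)) x t := by
  refine Run.seq (run_assign hs (a := 3) (by decide) (by decide) (by decide)
    (fun _ => by exact trivial) Finset.univ fun s' _ v _ _ => by
      simp [BExp.holds, IExp.eval]).frame ?_
  rintro s₁ hs₁ ⟨h3, hint₁, hval₁⟩
  have h3 := bundle_eq h3
  have hx₁ : s₁.ints 10 0 0 = x := by rw [hint₁ 10 (by decide), hx]
  have ht₁ : s₁.ints 11 0 0 = t := by rw [hint₁ 11 (by decide), ht]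
  have hb₁ := hb.congr (hint₁ 5 (by decide)) (hval₁ 3 (by decide))
  rw [← hval₁ 3 (by decide)]
  refine Run.seq (Q := fun s' => s' = s₁.setInt 14 0 0 x) (Run.setInt hs₁ (by decide) (by decide)
    (by decide) (by decide) (by simp [hx₁]; omega) (by simp [IExp.eval, hx₁])) ?_
  rintro s₂ hs₂ rfl
  refine Run.seq (run_flood hs₂ (t := t) (v := x) (by simp [State.ints_setInt, ht₁])
    (by simp [State.ints_setInt])).frame ?_
  rintro s₃ hs₃ ⟨h4, hint₃, hval₃⟩
  rw [bundle_setInt_of_ne _ _ _ _ (by decide), h3] at h4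
  refine Run.seq (run_assign hs₃ (a := 3) (by decide) (by decide) (by decide)
    (fun _ => by exact trivial) (I.bundle s₃ 4) fun s' _ v hv hint => ?_).frame ?_
  · rw [holds_isMem (I := I) (e := var 18) hv, bundle_congr (hint 4 (by decide) (by decide))]
  rintro s₄ hs₄ ⟨h3', hint₄, hval₄⟩
  have h3' := bundle_eq h3'
  rw [h4] at h3'
  have hv₄ : s₄.vals 3 = s₁.vals 3 := by
    rw [hval₄ 3 (by decide), hval₃ 3 (by decide), State.vals_setInt]
  have hb₄ : I.HoldsBest φ s₄ := hb₁.congr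
    (by rw [hint₄ 5 (by decide), hint₃ 5 (by decide), State.ints_setInt_of_ne _ _ _ _ (by decide)])
    hv₄
  have ht₄ : s₄.ints 11 0 0 = t := by
    rw [hint₄ 11 (by decide), hint₃ 11 (by decide), State.ints_setInt_of_ne _ _ _ _ (by decide), ht₁]
  rw [← hv₄]
  -- The bound in `Sweep` is the current best balance; it only rises, so `Sweep.mono` carries the
  -- earlier rounds along.
  refine (Run.forAll (fun k s' => I.HoldsBest φ s' ∧ φ (s₄.vals 3 0 0) ≤ φ (s'.vals 3 0 0) ∧
    Sweep I.G (I.weight φ 0) (φ (s'.vals 3 0 0)) x t k (I.bundle s' 3)) hs₄ (by decide)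
    (by decide) ?_ ?_).imp ?_
  · refine ⟨hb₄.congr (State.ints_setInt_of_ne _ _ _ _ (by decide)) rfl, le_rfl, ?_⟩
    rw [bundle_setInt_of_ne _ _ _ _ (by decide), h3']
    exact .zero
  · rintro k _ s₅ hs₅ _ hint₅ _ ⟨hb₅, hle₅, hsw₅⟩
    have hsep := hsw₅.separates hG hxt
    have ht₅ : s₅.ints 11 0 0 = t := by rw [hint₅ 11 (by decide), ht₄]
    refine Run.seq (run_evaluate hφ hs₅ hb₅ hsep.linked hsep.linked_compl).frame ?_
    rintro s₆ hs₆ ⟨⟨hb₆, hbal₆, hle₆⟩, hint₆, _⟩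
    have ht₆ : s₆.ints 11 0 0 = t := by rw [hint₆ 11 (by decide), ht₅]
    have hT₆ : I.bundle s₆ 3 = I.bundle s₅ 3 := bundle_congr (hint₆ 3 (by decide))
    refine (run_shrink hs₆ ht₆ (hT₆ ▸ hsep.linked) (hT₆ ▸ hsep.mem)).frame.imp ?_
    rintro s₇ _ ⟨hstep, hint₇, hval₇⟩
    rw [bundle_setInt_of_ne _ _ _ _ (by decide), State.vals_setInt]
    refine ⟨(hb₆.congr (hint₇ 5 (by decide)) (hval₇ 3 (by decide))).congr
      (State.ints_setInt_of_ne _ _ _ _ (by decide)) rfl, ?_, ?_⟩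
    · rw [hval₇ 3 (by decide)]
      exact hle₅.trans hle₆
    · rw [hval₇ 3 (by decide)]
      exact .succ (hsw₅.mono hle₆) hbal₆ (hT₆ ▸ hstep)
  · rintro s₅ _ ⟨h1, h2, h3⟩
    exact ⟨h1, h2, _, by simpa using h3⟩

theorem run_cut (hφ : StrictMono φ) (hG : I.G.Connected) {s : State R} (hs : I.Env s)
    (hb : I.HoldsBest φ s) :
    I.Run cut s fun s' => I.HoldsBest φ s' ∧
      ∀ x t, x ≠ t → SweepDone I.G (I.weight φ 0) (φ (s'.vals 3 0 0)) x t := by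
  refine (Run.forAll_forAll_visited (fun D s' => I.HoldsBest φ s' ∧
      ∀ p ∈ D, p.1 ≠ p.2 → SweepDone I.G (I.weight φ 0) (φ (s'.vals 3 0 0)) p.1 p.2) hs
    (by decide) (by decide) (by decide) (by decide) (by decide) ?_ ?_ ⟨hb, by simp⟩ ?_).imp ?_
  · intro D s' x h
    exact ⟨h.1.congr (State.ints_setInt_of_ne _ _ _ _ (by decide)) rfl, h.2⟩
  · intro D s' x h
    exact ⟨h.1.congr (State.ints_setInt_of_ne _ _ _ _ (by decide)) rfl, h.2⟩
  · rintro D x t s₁ hs₁ hx ht _ _ ⟨hb₁, hD⟩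
    refine Run.ite hs₁ (by decide) (by simp [isNe, BSized]) (fun h => ?_) (fun h => ?_)
    · rw [holds_isNe hx ht] at h
      refine (run_sweep hφ hG hs₁ hb₁ hx ht h).imp ?_
      rintro s₂ _ ⟨hb₂, hle, hdone⟩
      refine ⟨hb₂, ?_⟩
      rintro p (rfl | hp) hne
      · exact hdone
      · exact (hD p hp hne).mono hle
    · rw [holds_isNe hx ht] at h
      refine Run.skip hs₁ ⟨hb₁, ?_⟩
      rintro p (rfl | hp) hne
      · exact absurd hne h
      · exact hD p hp hne
  · rintro s' _ ⟨h1, h2⟩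
    exact ⟨h1, fun x t => h2 (x, t) trivial⟩

theorem run_chooseBundle (hφ : StrictMono φ) {s : State R} (hs : I.Env s) :
    I.Run chooseBundle s fun s' => ∃ X, (X = I.bundle s 5 ∨ X = (I.bundle s 5)ᶜ) ∧
      outputBundles I.n s' 0 = Xᶜ ∧ outputBundles I.n s' 1 = X ∧
      util (I.weight φ 1) Xᶜ ≤ util (I.weight φ 1) X := by
  refine Run.seq (run_sums hs 1 (a := 5) (by decide)).frame ?_
  rintro s₁ hs₁ ⟨⟨h1, h2⟩, hint₁, -⟩
  have h5 : I.bundle s₁ 5 = I.bundle s 5 := bundle_congr (hint₁ 5 (by decide))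
  generalize I.bundle s 5 = B at *
  have hout : ∀ (X : Finset (Fin I.n)) (s' : State R),
      (∀ v : Fin I.n, s'.ints 2 0 v = if v ∈ X then 1 else 0) →
      outputBundles I.n s' 0 = Xᶜ ∧ outputBundles I.n s' 1 = X := by
    intro X s' h
    constructor <;> ext v <;> simp [outputBundles, h]
  refine Run.ite hs₁ (by decide) ⟨trivial, trivial⟩ (fun h => ?_) (fun h => ?_)
  · simp only [BExp.holds, VExp.eval, IExp.eval, h1, h2] at h
    have h := hφ.monotone h
    rw [map_sum_eq_util, map_sum_eq_util] at h
    refine (run_assign hs₁ (a := 2) (by decide) (by decide) (by decide)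
      (fun _ => by exact trivial) B fun s' _ v hv hint => ?_).imp fun s' _ hs' => ?_
    · rw [holds_isMem (I := I) (e := var 18) hv, bundle_congr (hint 5 (by decide) (by decide)), h5]
    · exact ⟨B, .inl rfl, (hout B s' hs').1, (hout B s' hs').2, h⟩
  · simp only [BExp.holds, VExp.eval, IExp.eval, h1, h2, not_le] at h
    have h := hφ h
    rw [map_sum_eq_util, map_sum_eq_util] at h
    refine (run_assign hs₁ (a := 2) (by decide) (by decide) (by decide)
      (fun _ => by exact trivial) Bᶜ fun s' _ v hv hint => ?_).imp fun s' _ hs' => ?_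
    · rw [BExp.holds, holds_isMem (I := I) (e := var 18) hv, bundle_congr (hint 5 (by decide) (by decide)), h5,
        Finset.mem_compl]
    · exact ⟨Bᶜ, .inr rfl, (hout _ s' hs').1, (hout _ s' hs').2, by rw [compl_compl]; exact h.le⟩

end Values

end Problem

/-! ## Size of sums of rational numbers -/

theorem size_mul_le (x y : ℕ) : Nat.size (x * y) ≤ Nat.size x + Nat.size y := by
  rw [Nat.size_le, pow_add]
  exact Nat.mul_lt_mul'' (Nat.lt_size_self x) (Nat.lt_size_self y)

theorem size_add_le (x y : ℕ) : Nat.size (x + y) ≤ max (Nat.size x) (Nat.size y) + 1 := by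
  rw [Nat.size_le, pow_succ]
  have hx := (Nat.lt_size_self x).trans_le
    (Nat.pow_le_pow_right two_pos (le_max_left (Nat.size x) (Nat.size y)))
  have hy := (Nat.lt_size_self y).trans_le
    (Nat.pow_le_pow_right two_pos (le_max_right (Nat.size x) (Nat.size y)))
  omega

theorem size_den_pos (q : ℚ) : 1 ≤ Nat.size q.den :=
  Nat.size_pos.2 q.den_pos

theorem size_den_add_le (x y : ℚ) :
    Nat.size (x + y).den ≤ Nat.size x.den + Nat.size y.den :=
  (Nat.size_le_size (Nat.le_of_dvd (Nat.mul_pos x.den_pos y.den_pos)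
    (Rat.add_den_dvd x y))).trans (size_mul_le _ _)

/-- The reduced numerator divides the one obtained by cross-multiplication, unless the latter is
zero, in which case `x + y` is zero. -/
theorem size_num_add_le (x y : ℚ) :
    Nat.size (x + y).num.natAbs ≤ max (Nat.size x.num.natAbs + Nat.size y.den)
      (Nat.size x.den + Nat.size y.num.natAbs) + 1 := by
  have hle : (x + y).num.natAbs ≤ x.num.natAbs * y.den + x.den * y.num.natAbs := by
    have hsum := Rat.add_num_den x y
    by_cases h0 : x.num * y.den + x.den * y.num = 0
    · rw [h0, Rat.zero_divInt] at hsum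
      simp [hsum]
    · have hdvd : (x + y).num ∣ x.num * y.den + x.den * y.num := by
        rw [hsum]
        exact Rat.num_dvd _ (by exact_mod_cast (Nat.mul_pos x.den_pos y.den_pos).ne')
      have h1 := Nat.le_of_dvd (Int.natAbs_pos.2 h0) (Int.natAbs_dvd_natAbs.2 hdvd)
      have h2 := Int.natAbs_add_le (x.num * y.den) (x.den * y.num)
      simp only [Int.natAbs_mul, Int.natAbs_natCast] at h2
      omega
  refine (Nat.size_le_size hle).trans ((size_add_le _ _).trans ?_)
  have h1 := size_mul_le x.num.natAbs y.den
  have h2 := size_mul_le x.den y.num.natAbs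
  omega

theorem ratSize_sum_le {ι : Type*} (X : Finset ι) (f : ι → ℚ) :
    ratSize (∑ i ∈ X, f i) ≤ 3 * ∑ i ∈ X, ratSize (f i) + 1 := by
  classical
  -- The `+ 1` is the denominator of the empty sum. The factor 2 absorbs it and the carry of each
  -- addition, since every denominator has positive bit length.
  have key : Nat.size (∑ i ∈ X, f i).den ≤ ∑ i ∈ X, Nat.size (f i).den + 1 ∧
      Nat.size (∑ i ∈ X, f i).num.natAbs ≤
        ∑ i ∈ X, (Nat.size (f i).num.natAbs + 2 * Nat.size (f i).den) := by
    induction X using Finset.induction_on with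
    | empty => simp
    | insert a X ha ih =>
      rw [Finset.sum_insert ha, Finset.sum_insert ha, Finset.sum_insert ha]
      have h1 := size_den_add_le (f a) (∑ i ∈ X, f i)
      have h2 := size_num_add_le (f a) (∑ i ∈ X, f i)
      have h3 := size_den_pos (f a)
      have h4 : ∑ i ∈ X, Nat.size (f i).den ≤
          ∑ i ∈ X, (Nat.size (f i).num.natAbs + 2 * Nat.size (f i).den) :=
        Finset.sum_le_sum fun i _ => by omega
      omega
  have h : ∑ i ∈ X, Nat.size (f i).den +
      ∑ i ∈ X, (Nat.size (f i).num.natAbs + 2 * Nat.size (f i).den) ≤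
        3 * ∑ i ∈ X, ratSize (f i) := by
    rw [← Finset.sum_add_distrib, Finset.mul_sum]
    exact Finset.sum_le_sum fun i _ => by unfold ratSize; omega
  unfold ratSize at h ⊢
  omega

/-! ## Fairness for two agents -/

section TwoAgents

variable {V : Type*} [Fintype V] [DecidableEq V] {G : SimpleGraph V}

theorem IsConnectedAllocation.eq_compl {A : Fin 2 → Finset V} (hA : IsConnectedAllocation G A)
    {i j : Fin 2} (hij : i ≠ j) : A j = (A i)ᶜ := by
  ext v
  rw [Finset.mem_compl]
  refine ⟨fun hj hi => Finset.disjoint_left.1 (hA.2.1 i j hij) hi hj, fun hi => ?_⟩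
  have hv : v ∈ Finset.univ.biUnion A := by rw [hA.2.2]; exact Finset.mem_univ v
  obtain ⟨k, -, hk⟩ := Finset.mem_biUnion.1 hv
  have : k = j := by
    have : k ≠ i := fun h => hi (h ▸ hk)
    omega
  exact this ▸ hk

theorem isConnectedAllocation_of_eq {A : Fin 2 → Finset V} {X : Finset V} (hX : Linked G X)
    (hXc : Linked G Xᶜ) (h0 : A 0 = Xᶜ) (h1 : A 1 = X) : IsConnectedAllocation G A := by
  refine ⟨fun i => ?_, fun i j hij => ?_, ?_⟩
  · fin_cases i
    · exact isConnectedBundle_iff_linked.2 (h0 ▸ hXc)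
    · exact isConnectedBundle_iff_linked.2 (h1 ▸ hX)
  · fin_cases i <;> fin_cases j <;> simp_all [disjoint_compl_left, disjoint_compl_right]
  · ext v
    simp only [Finset.mem_biUnion, Finset.mem_univ, true_and, iff_true]
    by_cases hv : v ∈ X
    · exact ⟨1, h1 ▸ hv⟩
    · exact ⟨0, h0 ▸ Finset.mem_compl.2 hv⟩

theorem maximinShare_two_le {w : V → ℝ} {c : ℝ} (hc : 0 ≤ c)
    (h : ∀ X, Linked G X → Linked G Xᶜ → balance w X ≤ c) :
    maximinShare G w 2 Finset.univ ≤ c := by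
  refine Real.sSup_le ?_ hc
  rintro _ ⟨A, hA, rfl⟩
  have h1 := IsConnectedAllocation.eq_compl hA (i := 0) (j := 1) (by decide)
  have hl := fun i => isConnectedBundle_iff_linked.1 (hA.1 i)
  refine le_trans (le_min ?_ ?_) (h (A 0) (hl 0) (h1 ▸ hl 1))
  · exact ciInf_le (Set.finite_range _).bddBelow 0
  · rw [← h1]
    exact ciInf_le (Set.finite_range fun j => util w (A j)).bddBelow 1

theorem two_mul_balance_le_util_univ (w : V → ℝ) (X : Finset V) :
    2 * balance w X ≤ util w Finset.univ := by
  have h1 : balance w X ≤ util w X := min_le_left _ _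
  have h2 : balance w X ≤ util w Xᶜ := min_le_right _ _
  have := util_add_util_compl w X
  linarith

theorem two_mul_maximinShare_le {w : V → ℝ} (hw : ∀ v, 0 ≤ w v) :
    2 * maximinShare G w 2 Finset.univ ≤ util w Finset.univ := by
  have := maximinShare_two_le (G := G) (w := w) (c := util w Finset.univ / 2)
    (by have := util_nonneg hw Finset.univ; linarith)
    fun X _ _ => by have := two_mul_balance_le_util_univ w X; linarith
  linarith

/-- Only an agent with a nonempty bundle and no edge to the other needs an argument: she owns all of
`V`, which is worth at least twice her share. -/
theorem isApproxPMMS_iff_isApproxMMS (hG : G.Connected) {u : Fin 2 → V → ℝ}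
    (hu : ∀ i v, 0 ≤ u i v) {A : Fin 2 → Finset V} (hA : IsConnectedAllocation G A) :
    IsApproxPMMS G u (3 / 4) A ↔ IsApproxMMS G u (3 / 4) A := by
  have hunion : ∀ i j : Fin 2, i ≠ j → A i ∪ A j = Finset.univ := fun i j hij => by
    rw [hA.eq_compl hij, Finset.union_compl]
  constructor
  · intro h i
    obtain ⟨j, hij⟩ : ∃ j, i ≠ j := ⟨1 - i, by fin_cases i <;> decide⟩
    by_cases hadj : A i = ∅ ∨ AdjacentUnder G A i j
    · simpa only [hunion i j hij] using h i j hij hadj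
    · rw [not_or] at hadj
      obtain ⟨x, hx⟩ := Finset.nonempty_iff_ne_empty.2 hadj.1
      have huniv : A i = Finset.univ := by
        refine Finset.univ_subset_iff.1 fun y _ => ?_
        refine (reach_subset_of_closed (G := G) hx fun a ha b _ hab => ?_)
          (linked_univ hG x (Finset.mem_univ _) y (Finset.mem_univ _))
        by_contra hb
        exact hadj.2 ⟨a, ha, b, by rw [hA.eq_compl hij]; exact Finset.mem_compl.2 hb, hab⟩
      have h1 := two_mul_maximinShare_le (G := G) (hu i)
      have h2 := util_nonneg (hu i) Finset.univ
      rw [huniv]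
      linarith
  · intro h i j hij _
    rw [hunion i j hij]
    exact h i

end TwoAgents

/-! ## Correctness of the algorithm -/

namespace Problem

variable {R : Type} [AddCommGroup R] [LinearOrder R] {I : Problem R}

theorem env_inputState : I.Env (inputState I.G I.u) where
  int_le a i j := by
    simp only [inputState]
    split_ifs <;> omega
  val_le a i j := by
    simp only [inputState]
    split_ifs with h
    · simpa using I.sum_le ⟨i, h.2.1⟩ {⟨j, h.2.2⟩}
    · exact I.sz_zero_le
  size := by simp [inputState]
  adj x y := by
    by_cases h : I.G.Adj x y <;> simp [inputState, h]
  util i v := by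
    have : (i : ℕ) < 2 := i.isLt
    simp only [inputState, this, v.isLt, and_self, dif_pos]

theorem run_cutAndChoose {φ : R →+ ℝ} (hφ : StrictMono φ) (hG : I.G.Connected)
    (hu : ∀ i v, 0 ≤ I.weight φ i v) :
    I.Run cutAndChoose (inputState I.G I.u) fun s =>
      IsConnectedAllocation I.G (outputBundles I.n s) ∧
      IsApproxPMMS I.G (I.weight φ) (3 / 4) (outputBundles I.n s) ∧
      IsApproxMMS I.G (I.weight φ) (3 / 4) (outputBundles I.n s) := by
  -- The zero-initialised memory already encodes a valid best cut, the trivial one of balance 0. It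
  -- is also the final cut when there is no pair `s ≠ t`.
  have h5 : I.bundle (inputState I.G I.u) 5 = ∅ := by
    ext v
    simp [mem_bundle, inputState]
  have h0 : balance (I.weight φ 0) (∅ : Finset (Fin I.n)) = 0 := by
    simp [balance, util]
    exact Finset.sum_nonneg fun v _ => hu 0 v
  have hbest : I.HoldsBest φ (inputState I.G I.u) := by
    refine ⟨?_, ?_, ?_⟩
    · rw [h5, h0]; simp [inputState]
    · rw [h5]; exact linked_empty
    · rw [h5, Finset.compl_empty]; exact linked_univ hG
  refine Run.seq (run_cut hφ hG env_inputState hbest) ?_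
  rintro s₁ hs₁ ⟨hb, hdone⟩
  refine (run_chooseBundle hφ hs₁).imp ?_
  rintro s₂ _ ⟨X, hX, hA0, hA1, hu1⟩
  rw [hb.eq] at hdone
  have hopt := fun Y hY hYc => three_mul_balance_le (X := Y) hG (hu 0)
    (balance_nonneg (hu 0) (I.bundle s₁ 5)) hdone hY hYc
  have hXl : Linked I.G X ∧ Linked I.G Xᶜ ∧
      balance (I.weight φ 0) X = balance (I.weight φ 0) (I.bundle s₁ 5) := by
    rcases hX with rfl | rfl
    · exact ⟨hb.linked, hb.linked_compl, rfl⟩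
    · exact ⟨hb.linked_compl, by rw [compl_compl]; exact hb.linked, balance_compl _ _⟩
  have hA := isConnectedAllocation_of_eq hXl.1 hXl.2.1 hA0 hA1
  have hMMS : IsApproxMMS I.G (I.weight φ) (3 / 4) (outputBundles I.n s₂) := by
    rw [← hXl.2.2] at hopt
    have hmin : balance (I.weight φ 0) X ≤ util (I.weight φ 0) Xᶜ := min_le_right _ _
    have h1 := maximinShare_two_le (G := I.G) (w := I.weight φ 0) (c := 4 / 3 * balance (I.weight φ 0) X)
      (by have := balance_nonneg (hu 0) X; linarith)
      fun Y hY hYc => by have := hopt Y hY hYc; linarith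
    have h2 := two_mul_maximinShare_le (G := I.G) (hu 1)
    have h3 := util_add_util_compl (I.weight φ 1) X
    have h4 := util_nonneg (hu 1) X
    intro i
    fin_cases i
    · simp only [Fin.zero_eta, hA0]
      linarith
    · simp only [Fin.mk_one, hA1]
      linarith
  exact ⟨hA, (isApproxPMMS_iff_isApproxMMS hG hu hA).2 hMMS, hMMS⟩

end Problem
end GraphFairDivision

open GraphFairDivision
theorem mainTheorem2 :
    -- for two agents, (3/4)-PMMS and (3/4)-MMS are the same
    (∀ (n : ℕ) (G : SimpleGraph (Fin n)) (u : Fin 2 → Fin n → ℝ) (A : Fin 2 → Finset (Fin n)),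
      G.Connected → (∀ i v, 0 ≤ u i v) → IsConnectedAllocation G A →
        (IsApproxPMMS G u (3 / 4) A ↔ IsApproxMMS G u (3 / 4) A)) ∧
    -- one program computes such an allocation in polynomial time
    ∃ (P : Prog) (p : Polynomial ℕ),
      -- real utilities, unit cost of arithmetic on utilities
      (∀ (n : ℕ) (G : SimpleGraph (Fin n)) (u : Fin 2 → Fin n → ℝ),
        G.Connected → (∀ i v, 0 ≤ u i v) →
          ∃ (t : ℕ) (s : State ℝ),
            Exec (fun _ => 0) P (inputState G u) t s ∧
            t ≤ p.eval n ∧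
            IsConnectedAllocation G (outputBundles n s) ∧
            IsApproxPMMS G u (3 / 4) (outputBundles n s) ∧
            IsApproxMMS G u (3 / 4) (outputBundles n s)) ∧
      -- rational utilities, logarithmic (bit-length) cost
      (∀ (n : ℕ) (G : SimpleGraph (Fin n)) (u : Fin 2 → Fin n → ℚ),
        G.Connected → (∀ i v, 0 ≤ u i v) →
          ∃ (t : ℕ) (s : State ℚ),
            Exec ratSize P (inputState G u) t s ∧
            t ≤ p.eval (inputSize u) ∧
            IsConnectedAllocation G (outputBundles n s) ∧
            IsApproxPMMS G (fun i v => (u i v : ℝ)) (3 / 4) (outputBundles n s) ∧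
            IsApproxMMS G (fun i v => (u i v : ℝ)) (3 / 4) (outputBundles n s)) := by
  refine ⟨fun n G u A hG hu hA => isApproxPMMS_iff_isApproxMMS hG hu hA, ?_⟩
  obtain ⟨p, hp⟩ := cutAndChoose.exists_polynomial_bound
  -- The bound is evaluated at `I.n + I.K`. In both cases below `K` is chosen to make this exactly
  -- `4 * m + 3`, with `m` equal to `n` or `inputSize u`; for rationals that leaves room for the `3
  -- * ∑ + 1` of `ratSize_sum_le`.
  refine ⟨cutAndChoose, p.comp (4 * .X + 3), ?_, ?_⟩
  · intro n G u hG hu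
    let I : Problem ℝ := ⟨n, G, u, fun _ => 0, 3 * n + 3, fun _ _ => Nat.zero_le _⟩
    obtain ⟨t, s, h1, h2, _, h3⟩ := Problem.run_cutAndChoose (I := I) (φ := AddMonoidHom.id ℝ)
      strictMono_id hG hu
    refine ⟨t, s, h1, h2.trans (le_of_eq ?_), h3⟩
    rw [← hp]
    simp only [Polynomial.eval_comp, Polynomial.eval_add, Polynomial.eval_mul, Polynomial.eval_X,
      Polynomial.eval_ofNat, I]
    congr 1
    omega
  · intro n G u hG hu
    have hn : n ≤ inputSize u := Nat.le_add_right _ _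
    let I : Problem ℚ := ⟨n, G, u, ratSize, 4 * inputSize u + 3 - n, fun i X => by
      have h1 := ratSize_sum_le X (u i)
      have h2 : ∑ v ∈ X, ratSize (u i v) ≤ ∑ v, ratSize (u i v) :=
        Finset.sum_le_sum_of_subset (Finset.subset_univ X)
      have h3 : ∑ v, ratSize (u i v) ≤ ∑ i, ∑ v, ratSize (u i v) :=
        Finset.single_le_sum (f := fun i => ∑ v, ratSize (u i v)) (fun _ _ => Nat.zero_le _)
          (Finset.mem_univ i)
      unfold inputSize at *
      omega⟩
    obtain ⟨t, s, h1, h2, _, h3⟩ := Problem.run_cutAndChoose (I := I)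
      (φ := (Rat.castHom ℝ).toAddMonoidHom) (fun a b h => by simpa using h) hG
      (fun i v => by simpa [Problem.weight] using hu i v)
    refine ⟨t, s, h1, h2.trans (le_of_eq ?_), h3⟩
    rw [← hp]
    simp only [Polynomial.eval_comp, Polynomial.eval_add, Polynomial.eval_mul, Polynomial.eval_X,
      Polynomial.eval_ofNat, I]
    congr 1
    omega
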